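/- Let $X$ be a proper Gromov-hyperbolic metric space with base point $o$ and compact Gromov boundary $\partial X$ (geodesicity is not assumed), and let $\mathrm{Isom}(X)$ be the group of bijective isometries of $X$. Write $(x|y)=\frac12\bigl(d(x,o)+d(y,o)-d(x,y)\bigr)$. * The boundary $\partial X$ is the set of sequences $(x_i)$ in $X$ with $\lim_{i,j\to\infty}(x_i|x_j)=\infty$, modulo $(x_i)\sim(y_j)$ iff $\lim_{i,j\to\infty}(x_i|y_j)=\infty$, with the topology in which the sets $\{\eta : (\xi|\eta)>R\}$, $R\in\mathbb R$, form a neighbourhood base at $\xi$, where $(\xi|\eta)=\sup_{x_i\to\xi,\,y_j\to\eta}\liminf_{i,j\to\infty}(x_i|y_j)$. * The limit set of a semigroup $\Gamma\subseteq\mathrm{Isom}(X)$ is the set $\Lambda_\Gamma\subseteq\partial X$ of classes of such sequences taken in the orbit $\Gamma o$. * A set $S\subseteq X$ is separated if for some $\varepsilon>0$ all distinct $x,y\in S$ satisfy $d(x,y)>\varepsilon$. The entropy of $\Gamma$ is $$h_\Gamma=\sup_{S\ \text{separated}}\ \limsup_{n\to\infty}\frac1n\log\#\bigl(B(o,n)\cap\Gamma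 o\cap S\bigr)\in[0,\infty],$$ with $h_\Gamma=0$ if $\Gamma=\emptyset$. * Isometries $\gamma_n$ converge to $\gamma$ if $\gamma_n\to\gamma$ and $\gamma_n^{-1}\to\gamma^{-1}$ uniformly on every compact subset of $X$. Let $(\Gamma_n)_{n\in\mathbb N}$ and $\Gamma$ be semigroups of isometries of $X$ such that $\Lambda_\Gamma$ has at least two points, and suppose that $(\Gamma_n)$ converges to $\Gamma$ in one of the following senses: 1. geometrically: (a) every $\gamma\in\Gamma$ is the limit of a sequence $(\gamma_n)$ with $\gamma_n\in\Gamma_n$ for all $n$, and (b) whenever $P\subseteq\mathbb N$ is infinite, $\gamma_n\in\Gamma_n$ for $n\in P$, and $(\gamma_n)_{n\in P}$ converges to some $\gamma\in\mathrm{Isom}(X)$, then $\gamma\in\Gamma$; 2. algebraically: there are a semigroup $S$ and morphisms $\rho_n,\rho:S\to\mathrm{Isom}(X)$ with $\Gamma_n=\rho_n(S)$, $\Gamma=\rho(S)$, and $\rho_n(s)\to\rho(s)$ for every $s\in S$; 3. merely in the sense that (a) holds. Then $$h_\Gamma\le\liminf_{n\to\infty}h_{\Gamma_n}.$$ -/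

import Mathlib

open Filter Topology

universe u

noncomputable section

/-- The Gromov product `(x|y)` of `x` and `y` seen from the base point `o`. -/
def gromovProd {X : Type*} [MetricSpace X] (o x y : X) : ℝ :=
  (dist x o + dist y o - dist x y) / 2

/-- Gromov-hyperbolic metric spaces: there is `δ ≥ 0` such that
`(x|z) ≥ min {(x|y), (y|z)} - δ` for all points and all base points. -/
class IsGromovHyperbolic (X : Type*) [MetricSpace X] : Prop where
  exists_delta : ∃ δ : ℝ, 0 ≤ δ ∧ ∀ o x y z : X,
    min (gromovProd o x y) (gromovProd o y z) - δ ≤ gromovProd o x z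

/-- The sequences `(x_i)` and `(y_j)` satisfy `(x_i|y_j) → ∞` as `i, j → ∞`. -/
def GromovClose {X : Type*} [MetricSpace X] (o : X) (x y : ℕ → X) : Prop :=
  Tendsto (fun p : ℕ × ℕ => gromovProd o (x p.1) (y p.2)) atTop atTop

/-- Sequences converging at infinity: `(x_i|x_j) → ∞` as `i, j → ∞`. -/
def ConvSeq {X : Type*} [MetricSpace X] (o : X) : Type _ :=
  {x : ℕ → X // GromovClose o x x}

theorem gromovProd_comm {X : Type*} [MetricSpace X] (o x y : X) :
    gromovProd o x y = gromovProd o y x := by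
  unfold gromovProd; rw [dist_comm x y]; ring

theorem GromovClose.symm {X : Type*} [MetricSpace X] {o : X} {x y : ℕ → X}
    (h : GromovClose o x y) : GromovClose o y x := by
  unfold GromovClose at h ⊢
  rw [← prod_atTop_atTop_eq] at h ⊢
  refine (h.comp (tendsto_snd.prodMk tendsto_fst)).congr fun p => ?_
  exact gromovProd_comm _ _ _

theorem GromovClose.trans {X : Type*} [MetricSpace X] [IsGromovHyperbolic X] {o : X}
    {x y z : ℕ → X} (h₁ : GromovClose o x y) (h₂ : GromovClose o y z) : GromovClose o x z := by
  obtain ⟨δ, -, hδ⟩ := IsGromovHyperbolic.exists_delta (X := X)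
  unfold GromovClose at h₁ h₂ ⊢
  rw [tendsto_atTop] at h₁ h₂ ⊢
  intro b
  obtain ⟨p, hp⟩ := eventually_atTop.1 (h₁ (b + δ))
  obtain ⟨q, hq⟩ := eventually_atTop.1 (h₂ (b + δ))
  refine eventually_atTop.2 ⟨(p.1, q.2), fun r hr => ?_⟩
  have e₁ := hp (r.1, max p.2 q.1) ⟨hr.1, le_max_left _ _⟩
  have e₂ := hq (max p.2 q.1, r.2) ⟨le_max_right _ _, hr.2⟩
  have e₃ := hδ o (x r.1) (y (max p.2 q.1)) (z r.2)
  have e₄ := le_min e₁ e₂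
  linarith

/-- Two sequences converging at infinity are equivalent if `(x_i|y_j) → ∞`. -/
def convSetoid {X : Type*} [MetricSpace X] [IsGromovHyperbolic X] (o : X) : Setoid (ConvSeq o) where
  r x y := GromovClose o x.1 y.1
  iseqv := ⟨fun x => x.2, fun h => h.symm, fun h₁ h₂ => h₁.trans h₂⟩

/-- The Gromov boundary `∂X`, as the quotient of the sequences converging at infinity. -/
def GromovBoundary {X : Type*} [MetricSpace X] [IsGromovHyperbolic X] (o : X) : Type _ :=
  Quotient (convSetoid o)

/-- The boundary point defined by a sequence converging at infinity. -/
def ConvSeq.limit {X : Type*} [MetricSpace X] [IsGromovHyperbolic X] {o : X} (x : ConvSeq o) :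
    GromovBoundary o :=
  Quotient.mk (convSetoid o) x

/-- The Gromov product of two boundary points: the supremum of `liminf (x_i|y_j)` over all
sequences `x_i → ξ` and `y_j → η`. -/
def boundaryProd {X : Type*} [MetricSpace X] [IsGromovHyperbolic X] {o : X}
    (ξ η : GromovBoundary o) : EReal :=
  ⨆ (x : ConvSeq o) (_ : x.limit = ξ) (y : ConvSeq o) (_ : y.limit = η),
    liminf (fun p : ℕ × ℕ => (gromovProd o (x.1 p.1) (y.1 p.2) : EReal)) atTop

/-- The topology of the Gromov boundary: a set is open if with each of its points `ξ` it contains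
some `{η | (ξ|η) > R}`. -/
instance gromovBoundaryTopology {X : Type*} [MetricSpace X] [IsGromovHyperbolic X] (o : X) :
    TopologicalSpace (GromovBoundary o) where
  IsOpen U := ∀ ξ ∈ U, ∃ R : ℝ, {η | (R : EReal) < boundaryProd ξ η} ⊆ U
  isOpen_univ := fun _ _ => ⟨0, Set.subset_univ _⟩
  isOpen_inter := by
    rintro U V hU hV ξ ⟨h₁, h₂⟩
    obtain ⟨R, hR⟩ := hU ξ h₁
    obtain ⟨S, hS⟩ := hV ξ h₂
    refine ⟨max R S, fun η hη => ⟨hR ?_, hS ?_⟩⟩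
    · exact lt_of_le_of_lt (EReal.coe_le_coe_iff.2 (le_max_left R S)) hη
    · exact lt_of_le_of_lt (EReal.coe_le_coe_iff.2 (le_max_right R S)) hη
  isOpen_sUnion := by
    rintro s hs ξ ⟨U, hU, hξ⟩
    obtain ⟨R, hR⟩ := hs U hU ξ hξ
    exact ⟨R, hR.trans (Set.subset_sUnion_of_mem hU)⟩

/-- The boundary `∂A ⊆ ∂X` of a subset `A` of `X`. -/
def boundaryOf {X : Type*} [MetricSpace X] [IsGromovHyperbolic X] (o : X) (A : Set X) :
    Set (GromovBoundary o) :=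
  {ξ | ∃ x : ConvSeq o, (∀ i, x.1 i ∈ A) ∧ x.limit = ξ}

/-- The orbit `A o` of the base point under a set `A` of isometries. -/
def isomOrbit {X : Type*} [MetricSpace X] (o : X) (A : Set (X ≃ᵢ X)) : Set X :=
  (fun γ : X ≃ᵢ X => γ o) '' A

/-- The limit set of a semigroup of isometries: the boundary of the orbit of the base point. -/
def limitSet {X : Type*} [MetricSpace X] [IsGromovHyperbolic X] (o : X)
    (Γ : Subsemigroup (X ≃ᵢ X)) : Set (GromovBoundary o) :=
  boundaryOf o (isomOrbit o (Γ : Set (X ≃ᵢ X)))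

/-- The critical exponent `limsup (1/n) log #(B(o, n) ∩ P)` of a subset `P` of `X`, a value in
`[-∞, ∞]` (with `log 0 = -∞` and `log ∞ = ∞`). -/
def criticalExponent {X : Type*} [MetricSpace X] (o : X) (P : Set X) : EReal :=
  limsup (fun n : ℕ =>
    ENNReal.log ((Metric.closedBall o (n : ℝ) ∩ P).encard : ENNReal) / ((n : ℝ) : EReal)) atTop

/-- Separated subsets: distinct points are at distance `> ε`, for some `ε > 0`. -/
def IsSeparatedSet {X : Type*} [MetricSpace X] (S : Set X) : Prop :=
  ∃ ε : ℝ, 0 < ε ∧ S.Pairwise fun x y => ε < dist x y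

open Classical in
/-- The entropy of a subset `P` of `X`: the supremum of the critical exponents of `P ∩ S` over the
separated sets `S`, and `0` if `P` is empty. -/
def setEntropy {X : Type*} [MetricSpace X] (o : X) (P : Set X) : EReal :=
  if P = ∅ then 0 else ⨆ (S : Set X) (_ : IsSeparatedSet S), criticalExponent o (P ∩ S)

/-- The entropy of a semigroup of isometries: the entropy of the orbit of the base point. -/
def entropy {X : Type*} [MetricSpace X] (o : X) (Γ : Subsemigroup (X ≃ᵢ X)) : EReal :=
  setEntropy o (isomOrbit o (Γ : Set (X ≃ᵢ X)))

/-- Convergence of isometries along a filter: uniform convergence on every compact set, for the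
isometries and for their inverses. -/
def IsomTendsto {X ι : Type*} [MetricSpace X] (γ : ι → X ≃ᵢ X) (l : Filter ι) (g : X ≃ᵢ X) :
    Prop :=
  ∀ K : Set X, IsCompact K →
    TendstoUniformlyOn (fun n x => γ n x) (fun x => g x) l K ∧
    TendstoUniformlyOn (fun n x => (γ n).symm x) (fun x => g.symm x) l K

/-- Every element of `Γ` is a limit of elements `γ_n ∈ Γ_n`. -/
def IsApproximatedBy {X : Type*} [MetricSpace X] (Γs : ℕ → Subsemigroup (X ≃ᵢ X))
    (Γ : Subsemigroup (X ≃ᵢ X)) : Prop :=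
  ∀ g ∈ Γ, ∃ γ : ℕ → X ≃ᵢ X, (∀ n, γ n ∈ Γs n) ∧ IsomTendsto γ atTop g

/-- Geometric convergence: every element of `Γ` is a limit of elements `γ_n ∈ Γ_n`, and every limit
of elements `γ_n ∈ Γ_n`, with `n` in an infinite set `P` of integers, is in `Γ`. -/
def ConvergesGeometrically {X : Type*} [MetricSpace X] (Γs : ℕ → Subsemigroup (X ≃ᵢ X))
    (Γ : Subsemigroup (X ≃ᵢ X)) : Prop :=
  IsApproximatedBy Γs Γ ∧
  ∀ P : Set ℕ, P.Infinite → ∀ (γ : ℕ → X ≃ᵢ X) (g : X ≃ᵢ X), (∀ n ∈ P, γ n ∈ Γs n) →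
    IsomTendsto γ (atTop ⊓ 𝓟 P) g → g ∈ Γ

/-- Algebraic convergence: the `Γ_n` and `Γ` are the images of one semigroup `S` under morphisms
`ρ_n` and `ρ` such that `ρ_n(s) → ρ(s)` for every `s` in `S`. (Replacing `S` by its image in the
product of the targets, one sees that the universe of `S` is no restriction.) -/
def ConvergesAlgebraically {X : Type u} [MetricSpace X] (Γs : ℕ → Subsemigroup (X ≃ᵢ X))
    (Γ : Subsemigroup (X ≃ᵢ X)) : Prop :=
  ∃ (S : Type u) (_ : Semigroup S) (ρs : ℕ → S →ₙ* (X ≃ᵢ X)) (ρ : S →ₙ* (X ≃ᵢ X)),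
    (∀ n, Γs n = (ρs n).srange) ∧ Γ = ρ.srange ∧
    ∀ s, IsomTendsto (fun n => ρs n s) atTop (ρ s)

end

/-! ### Identities and inequalities for Gromov products -/

section GromovProduct

variable {X : Type*} [MetricSpace X]

/-! Each mode of convergence gives approximability of the elements of `Γ`, which is all that is
used. For `0 ≤ h < h_Γ`, look for a finite family in `Γ` whose words force entropy at least `h` for
a reason that survives small perturbations: lengths in `[j-1, j]`, orbit points far apart, products
`(f⁻¹o|f'o)` bounded, and at least `exp(h(j+1))` elements. By ping-pong, distinct words then give
separated points (`le_entropy_of_schottky`). Only finitely many points are involved, so the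
approximating elements of `Γ_n` inherit these properties (`exists_eventually_le_entropy`). Packing
and pigeonhole provide the annulus and the separation at an arbitrarily small loss of exponent; the
real task is to bound the products.

For this, take a separated part of the orbit, given by elements `g_i`, and an ultrafilter all of
whose members have large growth (`exists_ultrafilter_growth`). Compactness of `∂X` makes `g_i o` and
`g_i⁻¹ o` converge to boundary points `ξ⁺` and `ξ⁻` (`togetherAtInfinity_orbit`). If `b ξ⁺ ≠ ξ⁻` for
some `b ∈ Γ ∪ {1}`, the elements `b g_i`, for `i` in a member of the ultrafilter, have bounded
products.

Otherwise `ξ⁺ = ξ⁻ = ξ` is fixed by `Γ`. A second limit point yields a long `a ∈ Γ` with `a o` away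
from `ξ`, so that `a` repels from `ξ`. Multiplying `g_i` by the power of `a` that brings `g_i o`
closest to `o` pushes its orbit point away from `ξ`. The power is at most linear in the length, so
one power serves many `i`. The elements obtained fix `ξ` and send `o` away from it; their inverses
therefore send `o` towards `ξ`, and the products are bounded (`eventually_le_entropy_of_fixed`). -/

theorem gromovProd_self (o x : X) : gromovProd o x x = dist x o := by
  unfold gromovProd; rw [dist_self]; ring

theorem gromovProd_base (o x : X) : gromovProd o x o = 0 := by
  unfold gromovProd; rw [dist_self]; ring

theorem gromovProd_le_left (o x y : X) : gromovProd o x y ≤ dist x o := by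
  unfold gromovProd
  have := dist_triangle y x o
  rw [dist_comm y x] at this
  linarith

theorem gromovProd_le_right (o x y : X) : gromovProd o x y ≤ dist y o := by
  rw [gromovProd_comm]; exact gromovProd_le_left o y x

theorem dist_eq_sub_gromovProd (o x y : X) :
    dist x y = dist x o + dist y o - 2 * gromovProd o x y := by
  unfold gromovProd; ring

theorem gromovProd_le_add_dist_left (o x x' y : X) :
    gromovProd o x y ≤ gromovProd o x' y + dist x x' := by
  unfold gromovProd
  have h₁ := dist_triangle x x' o
  have h₂ := dist_triangle x' x y
  rw [dist_comm x' x] at h₂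
  linarith

theorem gromovProd_le_add_dist_right (o x y y' : X) :
    gromovProd o x y ≤ gromovProd o x y' + dist y y' := by
  rw [gromovProd_comm o x y, gromovProd_comm o x y']
  exact gromovProd_le_add_dist_left o y y' x

theorem dist_symm_apply_base (g : X ≃ᵢ X) (x y : X) : dist (g.symm x) y = dist x (g y) := by
  rw [← g.dist_eq (g.symm x) y, g.apply_symm_apply]

theorem dist_symm_base (g : X ≃ᵢ X) (o : X) : dist (g.symm o) o = dist (g o) o := by
  rw [dist_symm_apply_base, dist_comm]

/-- The exact form of ping-pong: if `w` is not in the direction of `g⁻¹o`, then `g w` is in the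
direction of `g o`. -/
theorem gromovProd_symm_add_gromovProd (o w : X) (g : X ≃ᵢ X) :
    gromovProd o (g.symm o) w + gromovProd o (g o) (g w) = dist (g o) o := by
  unfold gromovProd
  rw [dist_symm_base, dist_symm_apply_base g o w, g.dist_eq, dist_comm o (g w), dist_comm o w]
  ring

theorem gromovProd_map_ge (o x y : X) (g : X ≃ᵢ X) :
    gromovProd o x y - dist (g o) o ≤ gromovProd o (g x) (g y) := by
  unfold gromovProd
  rw [g.dist_eq]
  have h₁ := dist_triangle (g x) o (g o)
  have h₂ := dist_triangle (g y) o (g o)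
  rw [g.dist_eq, dist_comm o (g o)] at h₁ h₂
  linarith

end GromovProduct

/-! ### Convergence at infinity along filters -/

section TogetherAtInfinity

variable {X : Type*} [MetricSpace X] {ι κ μ : Type*}

/-- `(u i|v j) → ∞` as `i` and `j` tend to the filters `F` and `G`. -/
def TogetherAtInfinity (o : X) (F : Filter ι) (u : ι → X) (G : Filter κ) (v : κ → X) : Prop :=
  Tendsto (fun p : ι × κ => gromovProd o (u p.1) (v p.2)) (F ×ˢ G) atTop

variable {o : X} {F : Filter ι} {G : Filter κ} {H : Filter μ} {u : ι → X} {v : κ → X} {w : μ → X}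

theorem gromovClose_iff_togetherAtInfinity {x y : ℕ → X} :
    GromovClose o x y ↔ TogetherAtInfinity o atTop x atTop y := by
  unfold GromovClose TogetherAtInfinity
  rw [prod_atTop_atTop_eq]

theorem TogetherAtInfinity.eventually (h : TogetherAtInfinity o F u G v) (R : ℝ) :
    ∀ᶠ p in F ×ˢ G, R ≤ gromovProd o (u p.1) (v p.2) :=
  tendsto_atTop.1 h R

theorem TogetherAtInfinity.symm (h : TogetherAtInfinity o F u G v) :
    TogetherAtInfinity o G v F u := by
  unfold TogetherAtInfinity at h ⊢
  refine (h.comp (tendsto_snd.prodMk tendsto_fst)).congr fun p => ?_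
  exact gromovProd_comm _ _ _

theorem eventually_prod_trans [NeBot G] {P : ι → κ → Prop} {Q : κ → μ → Prop}
    (h₁ : ∀ᶠ p in F ×ˢ G, P p.1 p.2) (h₂ : ∀ᶠ p in G ×ˢ H, Q p.1 p.2) :
    ∀ᶠ p in F ×ˢ H, ∃ j, P p.1 j ∧ Q j p.2 := by
  obtain ⟨a, ha, b, hb, hab⟩ := eventually_prod_iff.1 h₁
  obtain ⟨b', hb', c, hc, hbc⟩ := eventually_prod_iff.1 h₂
  obtain ⟨j, hj, hj'⟩ := (hb.and hb').exists
  exact eventually_prod_iff.2 ⟨a, ha, c, hc, fun hx _ hy => ⟨j, hab hx hj, hbc hj' hy⟩⟩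

theorem TogetherAtInfinity.trans [IsGromovHyperbolic X] [NeBot G]
    (h₁ : TogetherAtInfinity o F u G v) (h₂ : TogetherAtInfinity o G v H w) :
    TogetherAtInfinity o F u H w := by
  obtain ⟨δ, -, hδ⟩ := IsGromovHyperbolic.exists_delta (X := X)
  refine tendsto_atTop.2 fun R => ?_
  refine (eventually_prod_trans (P := fun i j => R + δ ≤ gromovProd o (u i) (v j))
    (Q := fun j k => R + δ ≤ gromovProd o (v j) (w k))
    (h₁.eventually _) (h₂.eventually _)).mono ?_
  rintro ⟨i, k⟩ ⟨j, hj, hj'⟩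
  have := hδ o (u i) (v j) (w k)
  have := le_min hj hj'
  linarith

theorem TogetherAtInfinity.map_isometry (h : TogetherAtInfinity o F u G v) (g : X ≃ᵢ X) :
    TogetherAtInfinity o F (fun i => g (u i)) G (fun j => g (v j)) := by
  refine tendsto_atTop.2 fun R => ?_
  filter_upwards [h.eventually (R + dist (g o) o)] with p hp
  have := gromovProd_map_ge o (u p.1) (v p.2) g
  linarith

theorem eventually_prod_le_gromovProd_trans {δ : ℝ}
    (hδ : ∀ o x y z : X, min (gromovProd o x y) (gromovProd o y z) - δ ≤ gromovProd o x z)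
    {x y z : ℕ → X} {R : ℝ}
    (h₁ : ∀ᶠ p : ℕ × ℕ in atTop, R ≤ gromovProd o (x p.1) (y p.2))
    (h₂ : ∀ᶠ p : ℕ × ℕ in atTop, R ≤ gromovProd o (y p.1) (z p.2)) :
    ∀ᶠ p : ℕ × ℕ in atTop, R - δ ≤ gromovProd o (x p.1) (z p.2) := by
  rw [← prod_atTop_atTop_eq] at h₁ h₂ ⊢
  refine (eventually_prod_trans (P := fun i j => R ≤ gromovProd o (x i) (y j))
    (Q := fun i j => R ≤ gromovProd o (y i) (z j)) h₁ h₂).mono ?_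
  rintro ⟨i, k⟩ ⟨j, hj, hj'⟩
  have := hδ o (x i) (y j) (z k)
  have := le_min hj hj'
  linarith

/-- Two filters that converge to different points at infinity have bounded Gromov products. -/
theorem exists_eventually_gromovProd_le [IsGromovHyperbolic X]
    (hu : TogetherAtInfinity o F u F u) (hv : TogetherAtInfinity o G v G v)
    (h : ¬ TogetherAtInfinity o F u G v) :
    ∃ C, ∀ᶠ p in F ×ˢ G, gromovProd o (u p.1) (v p.2) ≤ C := by
  obtain ⟨δ, -, hδ⟩ := IsGromovHyperbolic.exists_delta (X := X)
  unfold TogetherAtInfinity at h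
  rw [tendsto_atTop] at h
  push Not at h
  obtain ⟨D, hD⟩ := h
  obtain ⟨A, hA, hA'⟩ := mem_prod_same_iff.1 (hu.eventually (D + 2 * δ))
  obtain ⟨B, hB, hB'⟩ := mem_prod_same_iff.1 (hv.eventually (D + 2 * δ))
  obtain ⟨⟨i, j⟩, hij, hi, hj⟩ := (hD.and_eventually (prod_mem_prod hA hB)).exists
  refine ⟨D + 2 * δ, ?_⟩
  -- A product above `D + 2δ` at `(i', j')` would pass to `(i, j)` by two hyperbolic inequalities,
  -- each costing `δ`, against the choice of `(i, j)`.
  filter_upwards [prod_mem_prod hA hB]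
  rintro ⟨i', j'⟩ ⟨hi', hj'⟩
  have e₁ : D + 2 * δ ≤ gromovProd o (u i) (u i') := hA' (Set.mk_mem_prod hi hi')
  have e₂ : D + 2 * δ ≤ gromovProd o (v j') (v j) := hB' (Set.mk_mem_prod hj' hj)
  by_contra! hc
  have e₃ := hδ o (u i) (u i') (v j)
  have e₄ := hδ o (u i') (v j') (v j)
  have e₅ := le_min hc.le e₂
  have e₆ : D + δ ≤ min (gromovProd o (u i) (u i')) (gromovProd o (u i') (v j)) := by
    refine le_min ?_ (by linarith)
    have : 0 ≤ δ := by
      have := hδ o o o o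
      rw [min_self] at this
      linarith
    linarith
  simp only at hij
  linarith

end TogetherAtInfinity

/-! ### Boundary topology and convergence of orbits -/

section Boundary

variable {X : Type*} [MetricSpace X] [IsGromovHyperbolic X] {o : X}

theorem ConvSeq.limit_eq_iff {x y : ConvSeq o} : x.limit = y.limit ↔ GromovClose o x.1 y.1 :=
  ⟨fun h => Quotient.exact h, fun h => Quotient.sound (s := convSetoid o) h⟩

theorem GromovBoundary.exists_limit_eq (ξ : GromovBoundary o) : ∃ x : ConvSeq o, x.limit = ξ :=
  Quotient.exists_rep ξ

theorem le_boundaryProd {x y : ConvSeq o} {R : ℝ}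
    (h : ∀ᶠ p : ℕ × ℕ in atTop, R ≤ gromovProd o (x.1 p.1) (y.1 p.2)) :
    (R : EReal) ≤ boundaryProd x.limit y.limit := by
  unfold boundaryProd
  refine le_trans ?_ (le_iSup₂_of_le x rfl (le_iSup₂_of_le y rfl le_rfl))
  exact le_liminf_of_le (by isBoundedDefault) (h.mono fun p hp => EReal.coe_le_coe_iff.2 hp)

theorem eventually_le_of_lt_boundaryProd {δ : ℝ}
    (hδ : ∀ o x y z : X, min (gromovProd o x y) (gromovProd o y z) - δ ≤ gromovProd o x z)
    {x y : ConvSeq o} {R : ℝ} (h : (R : EReal) < boundaryProd x.limit y.limit) :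
    ∀ᶠ p : ℕ × ℕ in atTop, R - 2 * δ ≤ gromovProd o (x.1 p.1) (y.1 p.2) := by
  unfold boundaryProd at h
  simp only [lt_iSup_iff] at h
  obtain ⟨x', hx', y', hy', h⟩ := h
  have e : ∀ᶠ p : ℕ × ℕ in atTop, R ≤ gromovProd o (x'.1 p.1) (y'.1 p.2) :=
    (eventually_lt_of_lt_liminf h).mono fun p hp => (EReal.coe_lt_coe_iff.1 hp).le
  have e₁ := tendsto_atTop.1 (ConvSeq.limit_eq_iff.1 hx'.symm) R
  have e₂ := tendsto_atTop.1 (ConvSeq.limit_eq_iff.1 hy') (R - δ)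
  have e₃ := eventually_prod_le_gromovProd_trans hδ
    (eventually_prod_le_gromovProd_trans hδ e₁ e) e₂
  exact e₃.mono fun p hp => by linarith

/-- The topology is defined by its open sets, so this needs an argument: the points having some
basic set inside the given one form an open set, by the approximate ultrametric inequality. -/
theorem setOf_lt_boundaryProd_mem_nhds (ξ : GromovBoundary o) (R : ℝ) :
    {η | (R : EReal) < boundaryProd ξ η} ∈ 𝓝 ξ := by
  obtain ⟨δ, hδ₀, hδ⟩ := IsGromovHyperbolic.exists_delta (X := X)
  refine mem_nhds_iff.2 ⟨{η | ∃ S : ℝ, {ω | (S : EReal) < boundaryProd η ω} ⊆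
    {ω | (R : EReal) < boundaryProd ξ ω}}, ?_, ?_, ⟨R, subset_rfl⟩⟩
  · rintro η ⟨S, hS⟩
    refine hS ?_
    obtain ⟨y, rfl⟩ := η.exists_limit_eq
    refine lt_of_lt_of_le ?_ (le_boundaryProd (tendsto_atTop.1 y.2 (S + 1)))
    exact EReal.coe_lt_coe_iff.2 (lt_add_one S)
  · rintro η ⟨S, hS⟩
    -- Passing to representatives costs `2δ`, the hyperbolic inequality `δ`; the `1` keeps the
    -- result strictly above `S`.
    refine ⟨S + 1 + 3 * δ, fun ω hω => ⟨S + 1 + 3 * δ, fun τ hτ => hS ?_⟩⟩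
    obtain ⟨y, rfl⟩ := η.exists_limit_eq
    obtain ⟨w, rfl⟩ := ω.exists_limit_eq
    obtain ⟨t, rfl⟩ := τ.exists_limit_eq
    have e := eventually_prod_le_gromovProd_trans hδ
      (eventually_le_of_lt_boundaryProd hδ hω) (eventually_le_of_lt_boundaryProd hδ hτ)
    refine lt_of_lt_of_le ?_ (le_boundaryProd e)
    exact EReal.coe_lt_coe_iff.2 (by linarith)

/-- Isometries that go to infinity along an ultrafilter and do not repel a given boundary point
converge on the base point, if the boundary is compact. -/
theorem togetherAtInfinity_orbit_of_convSeq [CompactSpace (GromovBoundary o)] {ι : Type*}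
    (F : Ultrafilter ι) (g : ι → X ≃ᵢ X)
    (hg : Tendsto (fun i => dist (g i o) o) F atTop) (x : ConvSeq o) (C : ℝ)
    (hx : ∀ᶠ i in (F : Filter ι), ∀ᶠ k in atTop, gromovProd o (x.1 k) ((g i).symm o) ≤ C) :
    TogetherAtInfinity o F (fun i => g i o) F (fun i => g i o) := by
  obtain ⟨δ, hδ₀, hδ⟩ := IsGromovHyperbolic.exists_delta (X := X)
  let gx : ι → ConvSeq o := fun i => ⟨fun k => g i (x.1 k), gromovClose_iff_togetherAtInfinity.2
    ((gromovClose_iff_togetherAtInfinity.1 x.2).map_isometry (g i))⟩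
  -- Compactness is applied to the translates of the given boundary point; the orbit points `g i o`
  -- then follow these translates.
  have hF := (F.map fun i => (gx i).limit).le_nhds_lim
  obtain ⟨y, hy⟩ := (F.map fun i => (gx i).limit).lim.exists_limit_eq
  rw [← hy] at hF
  refine tendsto_atTop.2 fun R => ?_
  have h₁ : ∀ᶠ i in (F : Filter ι), ((R + 4 * δ : ℝ) : EReal) < boundaryProd y.limit (gx i).limit :=
    hF (setOf_lt_boundaryProd_mem_nhds _ _)
  have h₂ : ∀ᶠ i in (F : Filter ι), ∀ᶠ k in atTop, R + δ ≤ gromovProd o (y.1 k) (g i o) := by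
    filter_upwards [h₁, hx, hg.eventually_ge_atTop (C + R + 2 * δ)] with i hi hxi hgi
    have h := eventually_le_of_lt_boundaryProd hδ hi
    rw [← prod_atTop_atTop_eq] at h
    filter_upwards [h.curry] with k hk
    obtain ⟨l, hl, hl'⟩ := (hk.and hxi).exists
    have e₁ := gromovProd_symm_add_gromovProd o (x.1 l) (g i)
    have e₂ := hδ o (y.1 k) (g i (x.1 l)) (g i o)
    rw [gromovProd_comm] at hl'
    have e₃ : R + 2 * δ ≤ min (gromovProd o (y.1 k) (g i (x.1 l)))
        (gromovProd o (g i (x.1 l)) (g i o)) := by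
      refine le_min ?_ ?_
      · simp only [gx] at hl
        linarith
      · rw [gromovProd_comm]
        linarith
    linarith
  filter_upwards [h₂.prod_mk h₂] with p hp
  obtain ⟨k, hk, hk'⟩ := (hp.1.and hp.2).exists
  have e₁ := hδ o (g p.1 o) (y.1 k) (g p.2 o)
  rw [gromovProd_comm] at hk
  have e₂ := le_min hk hk'
  linarith

theorem togetherAtInfinity_orbit [CompactSpace (GromovBoundary o)] [Nontrivial (GromovBoundary o)]
    {ι : Type*} (F : Ultrafilter ι) (g : ι → X ≃ᵢ X)
    (hg : Tendsto (fun i => dist (g i o) o) F atTop) :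
    TogetherAtInfinity o F (fun i => g i o) F (fun i => g i o) := by
  obtain ⟨δ, hδ₀, hδ⟩ := IsGromovHyperbolic.exists_delta (X := X)
  obtain ⟨ξ, η, hne⟩ := exists_pair_ne (GromovBoundary o)
  obtain ⟨x, rfl⟩ := ξ.exists_limit_eq
  obtain ⟨y, rfl⟩ := η.exists_limit_eq
  rw [Ne, ConvSeq.limit_eq_iff, gromovClose_iff_togetherAtInfinity] at hne
  obtain ⟨C, hC⟩ := exists_eventually_gromovProd_le
    (gromovClose_iff_togetherAtInfinity.1 x.2) (gromovClose_iff_togetherAtInfinity.1 y.2) hne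
  -- No point is close to two distinct boundary points at once, so one of the two is not repelled;
  -- the ultrafilter decides which.
  have key : ∀ z, (∀ᶠ k in atTop, gromovProd o (x.1 k) z ≤ C + δ) ∨
      ∀ᶠ k in atTop, gromovProd o (y.1 k) z ≤ C + δ := by
    intro z
    by_contra! h
    obtain ⟨h₁, h₂⟩ := h
    obtain ⟨i, hi, hi'⟩ := (h₁.and_eventually hC.curry).exists
    obtain ⟨j, hj, hj'⟩ := (h₂.and_eventually hi').exists
    have e := hδ o (x.1 i) z (y.1 j)
    rw [gromovProd_comm] at hj
    have := lt_min hi hj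
    simp only at hj'
    linarith
  have h : ∀ᶠ i in (F : Filter ι), (∀ᶠ k in atTop, gromovProd o (x.1 k) ((g i).symm o) ≤ C + δ) ∨
      ∀ᶠ k in atTop, gromovProd o (y.1 k) ((g i).symm o) ≤ C + δ :=
    Eventually.of_forall fun i => key _
  rcases Ultrafilter.eventually_or.1 h with h | h
  · exact togetherAtInfinity_orbit_of_convSeq F g hg x _ h
  · exact togetherAtInfinity_orbit_of_convSeq F g hg y _ h

end Boundary

/-! ### Elementary bounds for entropy -/

section EntropyBounds

variable {X : Type*} [MetricSpace X]

theorem coe_le_criticalExponent {o : X} {P : Set X} {h : ℝ}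
    (H : ∃ᶠ n : ℕ in atTop, ∃ F : Finset X, (F : Set X) ⊆ Metric.closedBall o (n : ℝ) ∩ P ∧
      Real.exp (h * n) ≤ F.card) :
    (h : EReal) ≤ criticalExponent o P := by
  unfold criticalExponent
  refine le_limsup_of_frequently_le ?_ (by isBoundedDefault)
  refine (H.and_eventually (eventually_gt_atTop 0)).mono ?_
  rintro n ⟨⟨F, hF, hcard⟩, hn⟩
  rw [EReal.le_div_iff_mul_le (by exact_mod_cast hn) (EReal.coe_ne_top _), ← EReal.coe_mul,
    ← EReal.log_exp ((h * n : ℝ) : EReal), ENNReal.log_le_log_iff, EReal.exp_coe]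
  have h₁ : (F.card : ENat) ≤ (Metric.closedBall o (n : ℝ) ∩ P).encard := by
    rw [← Set.encard_coe_eq_coe_finsetCard]
    exact Set.encard_le_encard hF
  calc ENNReal.ofReal (Real.exp (h * n)) ≤ ENNReal.ofReal F.card := ENNReal.ofReal_le_ofReal hcard
    _ = ((F.card : ENat) : ENNReal) := by simp
    _ ≤ _ := by exact_mod_cast h₁

theorem criticalExponent_le_setEntropy {o : X} {P S : Set X} (hP : P.Nonempty)
    (hS : IsSeparatedSet S) : criticalExponent o (P ∩ S) ≤ setEntropy o P := by
  rw [setEntropy, if_neg hP.ne_empty]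
  exact le_iSup₂_of_le S hS le_rfl

theorem setEntropy_nonneg (o : X) (P : Set X) : 0 ≤ setEntropy o P := by
  rcases P.eq_empty_or_nonempty with rfl | ⟨p, hp⟩
  · simp [setEntropy]
  · refine le_trans ?_ (criticalExponent_le_setEntropy ⟨p, hp⟩ (S := {p})
      ⟨1, one_pos, Set.pairwise_singleton _ _⟩)
    refine coe_le_criticalExponent (h := 0) (Eventually.frequently ?_)
    filter_upwards [eventually_ge_atTop ⌈dist p o⌉₊] with n hn
    refine ⟨{p}, ?_, by simp⟩
    simpa [hp] using Nat.ceil_le.1 hn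

end EntropyBounds

/-! ### Ping-pong and free Schottky semigroups -/

section Schottky

variable {X ι : Type*} [MetricSpace X] {o : X} {δ C : ℝ} {g : ι → X ≃ᵢ X}

/-- Induction on the word: its tail avoids the direction of `g_i⁻¹o`, so the word points towards
`g_i o`, which is away from every `g_j⁻¹o`. -/
theorem gromovProd_symm_word_le
    (hδ : ∀ o x y z : X, min (gromovProd o x y) (gromovProd o y z) - δ ≤ gromovProd o x z)
    (h₀ : 0 ≤ C + δ) (hC : ∀ i j, gromovProd o ((g i).symm o) (g j o) ≤ C)
    (hlen : ∀ i, 2 * C + 2 * δ + 1 ≤ dist (g i o) o) (w : List ι) (j : ι) :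
    gromovProd o ((g j).symm o) ((w.map g).prod o) ≤ C + δ := by
  induction w generalizing j with
  | nil =>
    simp only [List.map_nil, List.prod_nil]
    exact (gromovProd_base o _).trans_le h₀
  | cons i w ih =>
    rw [List.map_cons, List.prod_cons, IsometryEquiv.mul_apply]
    have e₁ := gromovProd_symm_add_gromovProd o ((w.map g).prod o) (g i)
    have e₂ := hδ o ((g j).symm o) (g i ((w.map g).prod o)) (g i o)
    have e₃ := ih i
    have e₄ := hlen i
    have e₅ := hC j i
    rw [gromovProd_comm o (g i o)] at e₁
    by_contra! hc
    have : C + δ < min (gromovProd o ((g j).symm o) (g i ((w.map g).prod o)))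
        (gromovProd o (g i ((w.map g).prod o)) (g i o)) := lt_min hc (by linarith)
    linarith

theorem le_gromovProd_cons_word
    (hδ : ∀ o x y z : X, min (gromovProd o x y) (gromovProd o y z) - δ ≤ gromovProd o x z)
    (h₀ : 0 ≤ C + δ) (hC : ∀ i j, gromovProd o ((g i).symm o) (g j o) ≤ C)
    (hlen : ∀ i, 2 * C + 2 * δ + 1 ≤ dist (g i o) o) (w : List ι) (i : ι) :
    dist (g i o) o - C - δ ≤ gromovProd o (g i o) (((i :: w).map g).prod o) := by
  rw [List.map_cons, List.prod_cons, IsometryEquiv.mul_apply]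
  have e₁ := gromovProd_symm_add_gromovProd o ((w.map g).prod o) (g i)
  have e₂ := gromovProd_symm_word_le hδ h₀ hC hlen w i
  linarith

/-- After cancelling the common prefix, the first letters differ, and each word follows its first
letter up to `C + δ`. Thus the words lie about as far apart as the orbit points of these letters. -/
theorem one_le_dist_word (hδ₀ : 0 ≤ δ)
    (hδ : ∀ o x y z : X, min (gromovProd o x y) (gromovProd o y z) - δ ≤ gromovProd o x z)
    (h₀ : 0 ≤ C) (hC : ∀ i j, gromovProd o ((g i).symm o) (g j o) ≤ C)
    (hlen : ∀ i, 2 * C + 2 * δ + 1 ≤ dist (g i o) o)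
    (hwidth : ∀ i j, dist (g i o) o ≤ dist (g j o) o + 2)
    (hsep : ∀ i j, i ≠ j → 2 * C + 6 * δ + 4 ≤ dist (g i o) (g j o)) (w w' : List ι)
    (hne : w ≠ w') :
    1 ≤ dist ((w.map g).prod o) ((w'.map g).prod o) := by
  have h₁ : 0 ≤ C + δ := by linarith
  have hcons : ∀ i w, 1 ≤ dist (((i :: w).map g).prod o) o := fun i w => by
    have e₁ := le_gromovProd_cons_word hδ h₁ hC hlen w i
    have e₂ := gromovProd_le_right o (g i o) (((i :: w).map g).prod o)
    have e₃ := hlen i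
    linarith
  induction w generalizing w' with
  | nil =>
    cases w' with
    | nil => exact absurd rfl hne
    | cons j w' =>
      rw [dist_comm]
      exact hcons j w'
  | cons i w ih =>
    cases w' with
    | nil => exact hcons i w
    | cons j w' =>
      by_cases hij : i = j
      · subst hij
        rw [List.map_cons, List.prod_cons, List.map_cons, List.prod_cons,
          IsometryEquiv.mul_apply, IsometryEquiv.mul_apply, (g i).dist_eq]
        exact ih w' fun h => hne (by rw [h])
      · have e₁ := le_gromovProd_cons_word hδ h₁ hC hlen w i
        have e₂ := le_gromovProd_cons_word hδ h₁ hC hlen w' j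
        set x := ((i :: w).map g).prod o
        set y := ((j :: w').map g).prod o
        have d₁ := gromovProd_le_right o (g i o) x
        have d₂ := gromovProd_le_right o (g j o) y
        have e₃ := hsep i j hij
        have e₄ := dist_eq_sub_gromovProd o (g i o) (g j o)
        have e₅ := dist_eq_sub_gromovProd o x y
        have w₁ := hwidth i j
        have w₂ := hwidth j i
        have t₁ := hδ o (g i o) x y
        have t₂ := hδ o (g i o) y (g j o)
        rw [gromovProd_comm o y (g j o)] at t₂
        -- Near-equality of lengths and `hsep` keep `(g_i o|g_j o)` so far below both lengths that
        -- the words branch where their first letters do.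
        have key : gromovProd o x y ≤ gromovProd o (g i o) (g j o) + 2 * δ := by
          by_contra! hc
          have m₁ : gromovProd o (g i o) (g j o) + 2 * δ <
              min (gromovProd o (g i o) x) (gromovProd o x y) := lt_min (by linarith) hc
          have m₂ : gromovProd o (g i o) (g j o) + δ <
              min (gromovProd o (g i o) y) (gromovProd o (g j o) y) :=
            lt_min (by linarith) (by linarith)
          linarith
        linarith

theorem dist_word_le {N : ℝ} (hN : ∀ i, dist (g i o) o ≤ N) (w : List ι) :
    dist ((w.map g).prod o) o ≤ w.length * N := by
  induction w with
  | nil => simp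
  | cons i w ih =>
    rw [List.map_cons, List.prod_cons, IsometryEquiv.mul_apply, List.length_cons]
    have e₁ := dist_triangle (g i ((w.map g).prod o)) (g i o) o
    rw [(g i).dist_eq] at e₁
    have e₂ := hN i
    push_cast
    linarith

theorem word_mem (Γ : Subsemigroup (X ≃ᵢ X)) (hg : ∀ i, g i ∈ Γ) (i : ι) (w : List ι) :
    ((i :: w).map g).prod ∈ Γ := by
  induction w generalizing i with
  | nil => simpa using hg i
  | cons j w ih =>
    rw [List.map_cons, List.prod_cons]
    exact Γ.mul_mem (hg i) (ih j)

/-- A semigroup that contains a free Schottky family of `k` isometries of length at most `N` has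
entropy at least `log k / N`. -/
theorem le_entropy_of_schottky [Fintype ι] {N : ℕ} {h : ℝ} (hδ₀ : 0 ≤ δ)
    (hδ : ∀ o x y z : X, min (gromovProd o x y) (gromovProd o y z) - δ ≤ gromovProd o x z)
    (h₀ : 0 ≤ C) (hC : ∀ i j, gromovProd o ((g i).symm o) (g j o) ≤ C)
    (hlen : ∀ i, 2 * C + 2 * δ + 1 ≤ dist (g i o) o)
    (hwidth : ∀ i j, dist (g i o) o ≤ dist (g j o) o + 2)
    (hsep : ∀ i j, i ≠ j → 2 * C + 6 * δ + 4 ≤ dist (g i o) (g j o))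
    (hN₀ : 0 < N) (hN : ∀ i, dist (g i o) o ≤ N)
    (hcard : Real.exp (h * N) ≤ Fintype.card ι)
    (Γ : Subsemigroup (X ≃ᵢ X)) (hg : ∀ i, g i ∈ Γ) :
    (h : EReal) ≤ entropy o Γ := by
  classical
  have hsepw := one_le_dist_word hδ₀ hδ h₀ hC hlen hwidth hsep
  have hι : Nonempty ι := by
    have := (Real.exp_pos _).trans_le hcard
    exact Fintype.card_pos_iff.1 (by exact_mod_cast this)
  let S : Set X := Set.range fun w : List ι => (w.map g).prod o
  have hS : IsSeparatedSet S := by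
    refine ⟨1 / 2, by norm_num, ?_⟩
    rintro _ ⟨w, rfl⟩ _ ⟨w', rfl⟩ hne
    refine lt_of_lt_of_le (by norm_num) (hsepw w w' ?_)
    rintro rfl
    exact hne rfl
  have hP : (isomOrbit o (Γ : Set (X ≃ᵢ X))).Nonempty :=
    ⟨_, Set.mem_image_of_mem _ (hg hι.some)⟩
  refine le_trans ?_ (criticalExponent_le_setEntropy hP hS)
  -- Words of length `a + 1` are counted at radius `(a + 1) N`; they are nonempty because `Γ` may
  -- lack the identity.
  refine coe_le_criticalExponent (frequently_atTop.2 fun a => ⟨(a + 1) * N, by nlinarith, ?_⟩)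
  let φ : (Fin (a + 1) → ι) → X := fun v => ((List.ofFn v).map g).prod o
  have hφ : Function.Injective φ := by
    intro v v' hv
    by_contra hne
    have := hsepw (List.ofFn v) (List.ofFn v') fun h => hne (List.ofFn_injective h)
    have hv : ((List.ofFn v).map g).prod o = ((List.ofFn v').map g).prod o := hv
    rw [hv, dist_self] at this
    linarith
  refine ⟨Finset.univ.image φ, ?_, ?_⟩
  · intro x hx
    simp only [Finset.coe_image, Finset.coe_univ, Set.image_univ, Set.mem_range] at hx
    obtain ⟨v, rfl⟩ := hx
    refine ⟨?_, ?_, ⟨List.ofFn v, rfl⟩⟩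
    · rw [Metric.mem_closedBall]
      have := dist_word_le hN (List.ofFn v)
      rw [List.length_ofFn] at this
      push_cast at this ⊢
      exact this
    · refine ⟨((List.ofFn v).map g).prod, ?_, rfl⟩
      rw [List.ofFn_succ]
      exact word_mem Γ hg _ _
  · rw [Finset.card_image_of_injective _ hφ, Finset.card_univ, Fintype.card_fun, Fintype.card_fin]
    push_cast
    calc Real.exp (h * (((a : ℝ) + 1) * N)) = Real.exp (h * N) ^ (a + 1) := by
          rw [← Real.exp_nat_mul]
          congr 1
          push_cast
          ring
      _ ≤ _ := pow_le_pow_left₀ (Real.exp_pos _).le hcard _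

end Schottky

/-! ### Packing and extraction of a thin annulus -/

section Packing

variable {X : Type*} [MetricSpace X]

/-- In a proper space, the number of `ε`-separated points in a ball of radius `R` centred at an
orbit point is bounded. -/
theorem exists_card_le_of_separated [ProperSpace X] (o : X) {ε : ℝ} (hε : 0 < ε) (R : ℝ) :
    ∃ N : ℕ, ∀ (g : X ≃ᵢ X) (B : Finset (X ≃ᵢ X)),
      (B : Set (X ≃ᵢ X)).Pairwise (fun f f' => ε < dist (f o) (f' o)) →
      (∀ f ∈ B, dist (f o) (g o) ≤ R) → B.card ≤ N := by
  obtain ⟨t, -, htf, ht⟩ := (isCompact_closedBall o R).finite_cover_balls (half_pos hε)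
  refine ⟨htf.toFinset.card, fun g B hB hBR => ?_⟩
  -- Translating by `g⁻¹` lets a single cover of the ball at `o` serve all centres.
  have hc : ∀ f ∈ B, ∃ x ∈ t, dist (g.symm (f o)) x < ε / 2 := fun f hf => by
    have : g.symm (f o) ∈ Metric.closedBall o R := by
      rw [Metric.mem_closedBall, dist_symm_apply_base]
      exact hBR f hf
    simpa using ht this
  have : Nonempty X := ⟨o⟩
  choose! c hct hc using hc
  refine Finset.card_le_card_of_injOn c (fun f hf => by simpa using hct f hf) ?_
  intro f hf f' hf' hcc
  by_contra hne
  have h₁ := hB hf hf' hne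
  have h₂ := hc f hf
  have h₃ := hc f' hf'
  rw [← hcc] at h₃
  have h₄ := dist_triangle_right (g.symm (f o)) (g.symm (f' o)) (c f)
  rw [g.symm.dist_eq] at h₄
  linarith

/-- A maximal `R`-separated subset is `R`-dense in `B`, and each of its points accounts for at most
`N` elements. -/
theorem exists_separated_subset (o : X) {R : ℝ} (hR : 0 ≤ R) {N : ℕ} (B : Finset (X ≃ᵢ X))
    (hN : ∀ g ∈ B, ∀ A ⊆ B, (∀ f ∈ A, dist (f o) (g o) ≤ R) → A.card ≤ N) :
    ∃ F ⊆ B, (F : Set (X ≃ᵢ X)).Pairwise (fun f f' => R ≤ dist (f o) (f' o)) ∧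
      B.card ≤ N * F.card := by
  classical
  obtain ⟨F, hF⟩ := Finset.exists_maximal (s := B.powerset.filter fun F : Finset (X ≃ᵢ X) =>
    (F : Set (X ≃ᵢ X)).Pairwise fun f f' => R ≤ dist (f o) (f' o)) ⟨∅, by simp⟩
  have hF' := hF.prop
  rw [Finset.mem_filter, Finset.mem_powerset] at hF'
  obtain ⟨hFB, hFR⟩ := hF'
  refine ⟨F, hFB, hFR, ?_⟩
  have hφ : ∀ b ∈ B, ∃ f ∈ F, dist (b o) (f o) ≤ R := by
    intro b hb
    by_contra! hc
    have hmem : insert b F ∈ B.powerset.filter fun F : Finset (X ≃ᵢ X) =>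
        (F : Set (X ≃ᵢ X)).Pairwise fun f f' => R ≤ dist (f o) (f' o) := by
      simp only [Finset.mem_filter, Finset.mem_powerset, Finset.coe_insert]
      refine ⟨Finset.insert_subset hb hFB, hFR.insert fun f hf _ => ⟨(hc f hf).le, ?_⟩⟩
      rw [dist_comm]
      exact (hc f hf).le
    have hbF : b ∈ F := hF.2 hmem (Finset.subset_insert b F) (Finset.mem_insert_self b F)
    have := hc b hbF
    rw [dist_self] at this
    linarith
  choose! φ hφF hφ using hφ
  refine Finset.card_le_mul_card_image_of_maps_to hφF N fun f hf => ?_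
  refine hN f (hFB hf) _ (Finset.filter_subset _ _) fun b hb => ?_
  obtain ⟨hb, hbf⟩ := Finset.mem_filter.1 hb
  exact hbf ▸ hφ b hb

theorem eventually_add_mul_exp_lt {h h' : ℝ} (h₀ : 0 ≤ h) (hh : h < h') (A B : ℝ) :
    ∀ᶠ x : ℝ in atTop, A + B * (x + 2) * Real.exp (h * (x + 2)) < Real.exp (h' * x) := by
  have hb : 0 < h' - h := sub_pos.2 hh
  let a := |A| + 2 * B * Real.exp (h * 2)
  let b := B * Real.exp (h * 2)
  have e₀ := (isLittleO_pow_exp_pos_mul_atTop 0 hb).const_mul_left a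
  have e₁ := (isLittleO_pow_exp_pos_mul_atTop 1 hb).const_mul_left b
  filter_upwards [(e₀.add e₁).def (half_pos one_pos), eventually_ge_atTop 0] with x hx hx0
  rw [Real.norm_eq_abs, Real.norm_eq_abs, abs_of_pos (Real.exp_pos _)] at hx
  have h₁ : a + b * x < Real.exp ((h' - h) * x) := by
    have h₂ := (le_abs_self _).trans hx
    have h₃ := Real.exp_pos ((h' - h) * x)
    simp only [pow_zero, pow_one, mul_one] at h₂
    linarith
  have h₄ : A ≤ |A| * Real.exp (h * x) :=
    (le_abs_self A).trans (le_mul_of_one_le_right (abs_nonneg A)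
      (Real.one_le_exp (mul_nonneg h₀ hx0)))
  calc A + B * (x + 2) * Real.exp (h * (x + 2))
      = A + (2 * B * Real.exp (h * 2) + b * x) * Real.exp (h * x) := by
        rw [mul_add h, Real.exp_add]
        ring
    _ ≤ (a + b * x) * Real.exp (h * x) := by
        simp only [a]
        linarith
    _ < Real.exp ((h' - h) * x) * Real.exp (h * x) :=
        mul_lt_mul_of_pos_right h₁ (Real.exp_pos _)
    _ = Real.exp (h' * x) := by
        rw [← Real.exp_add]
        ring_nf

/-- A large separated family of isometries contains a large, widely separated family whose lengths
differ by at most one. -/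
theorem exists_annulus_subset [ProperSpace X] (o : X) {ε h h' L R : ℝ} (hε : 0 < ε) (h₀ : 0 ≤ h) (hh : h < h')
    (hR : 0 ≤ R) :
    ∃ m₀ : ℝ, ∀ m ≥ m₀, ∀ B : Finset (X ≃ᵢ X),
      (B : Set (X ≃ᵢ X)).Pairwise (fun f f' => ε < dist (f o) (f' o)) →
      (∀ f ∈ B, dist (f o) o ≤ m) → Real.exp (h' * m) ≤ B.card →
      ∃ (j : ℕ) (F : Finset (X ≃ᵢ X)), F ⊆ B ∧
        (F : Set (X ≃ᵢ X)).Pairwise (fun f f' => R ≤ dist (f o) (f' o)) ∧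
        (∀ f ∈ F, L ≤ dist (f o) o ∧ (j : ℝ) - 1 ≤ dist (f o) o ∧ dist (f o) o ≤ j) ∧
        Real.exp (h * (j + 1)) ≤ F.card := by
  classical
  obtain ⟨N₁, hN₁⟩ := exists_card_le_of_separated o hε L
  obtain ⟨N₂, hN₂⟩ := exists_card_le_of_separated o hε R
  obtain ⟨m₀, hm₀⟩ := eventually_atTop.1 (eventually_add_mul_exp_lt h₀ hh N₁ N₂)
  refine ⟨max m₀ 0, fun m hm B hB hBm hcard => ?_⟩
  have hm' := hm₀ m (le_trans (le_max_left _ _) hm)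
  have hm0 : 0 ≤ m := le_trans (le_max_right _ _) hm
  let M := ⌈m⌉₊
  have hM : (M : ℝ) ≤ m + 1 := (Nat.ceil_lt_add_one hm0).le
  by_contra! hc
  -- If every annulus failed, summing over about `m` annuli and adding the boundedly many short
  -- elements would give fewer than `exp(h' m)` elements.
  let D : ℕ → Finset (X ≃ᵢ X) := fun j =>
    (B.filter fun f => L ≤ dist (f o) o).filter fun f => ⌈dist (f o) o⌉₊ = j
  have hDB : ∀ j, D j ⊆ B := fun j => (Finset.filter_subset _ _).trans (Finset.filter_subset _ _)
  have hD : ∀ j ∈ Finset.range (M + 1), ((D j).card : ℝ) ≤ N₂ * Real.exp (h * (m + 2)) := by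
    intro j hj
    obtain ⟨F, hFD, hFR, hF⟩ := exists_separated_subset o hR (N := N₂) (D j)
      fun g hg A hA => hN₂ g A (hB.mono fun f hf => hDB j (hA hf))
    have h₁ := hc j F (hFD.trans (hDB j)) hFR ?_
    · have h₂ : (j : ℝ) ≤ M := by
        exact_mod_cast Nat.lt_succ_iff.1 (Finset.mem_range.1 hj)
      have h₃ : Real.exp (h * (j + 1)) ≤ Real.exp (h * (m + 2)) := by
        refine Real.exp_le_exp.2 (mul_le_mul_of_nonneg_left ?_ h₀)
        linarith
      calc ((D j).card : ℝ) ≤ N₂ * F.card := by exact_mod_cast hF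
        _ ≤ _ := by
          refine mul_le_mul_of_nonneg_left ?_ (Nat.cast_nonneg _)
          linarith
    · intro f hf
      have hf := hFD hf
      simp only [D, Finset.mem_filter] at hf
      obtain ⟨⟨hfB, hfL⟩, rfl⟩ := hf
      have := Nat.ceil_lt_add_one (dist_nonneg (x := f o) (y := o))
      exact ⟨hfL, by linarith, Nat.le_ceil _⟩
  have h₁ : ((B.filter fun f => ¬ L ≤ dist (f o) o).card : ℝ) ≤ N₁ := by
    refine Nat.cast_le.2 (hN₁ 1 _ (hB.mono fun f hf => Finset.filter_subset _ _ hf) fun f hf => ?_)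
    exact (not_le.1 (Finset.mem_filter.1 hf).2).le
  have h₂ : ((B.filter fun f => L ≤ dist (f o) o).card : ℝ) ≤
      (M + 1) * (N₂ * Real.exp (h * (m + 2))) := by
    rw [Finset.card_eq_sum_card_fiberwise (f := fun f : X ≃ᵢ X => ⌈dist (f o) o⌉₊)
      (t := Finset.range (M + 1))]
    · push_cast
      refine (Finset.sum_le_sum hD).trans ?_
      simp
    · intro f hf
      have := hBm f (Finset.filter_subset _ _ hf)
      simpa [Nat.lt_succ_iff] using Nat.ceil_mono this
  have h₃ : (B.card : ℝ) = (B.filter fun f => L ≤ dist (f o) o).card +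
      (B.filter fun f => ¬ L ≤ dist (f o) o).card := by
    exact_mod_cast (Finset.card_filter_add_card_filter_not _).symm
  have h₄ : ((M : ℝ) + 1) * (N₂ * Real.exp (h * (m + 2))) ≤
      N₂ * (m + 2) * Real.exp (h * (m + 2)) := by
    have : 0 ≤ N₂ * Real.exp (h * (m + 2)) := by positivity
    calc ((M : ℝ) + 1) * (N₂ * Real.exp (h * (m + 2)))
        ≤ (m + 2) * (N₂ * Real.exp (h * (m + 2))) :=
          mul_le_mul_of_nonneg_right (by linarith) this
      _ = _ := by ring
  linarith

end Packing

/-! ### Perturbation of Schottky families -/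

section Approximation

variable {X : Type*} [MetricSpace X]

theorem IsomTendsto.eventually_dist_lt {γ : ℕ → X ≃ᵢ X} {g : X ≃ᵢ X}
    (h : IsomTendsto γ atTop g) (o : X) {ε : ℝ} (hε : 0 < ε) :
    ∀ᶠ n in atTop, dist (γ n o) (g o) < ε ∧ dist ((γ n).symm o) (g.symm o) < ε := by
  obtain ⟨h₁, h₂⟩ := h {o} isCompact_singleton
  filter_upwards [Metric.tendstoUniformlyOn_iff.1 h₁ ε hε,
    Metric.tendstoUniformlyOn_iff.1 h₂ ε hε] with n hn hn'
  rw [dist_comm, dist_comm ((γ n).symm o)]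
  exact ⟨hn o rfl, hn' o rfl⟩

theorem isApproximatedBy_of_convergesAlgebraically {Γs : ℕ → Subsemigroup (X ≃ᵢ X)}
    {Γ : Subsemigroup (X ≃ᵢ X)} (h : ConvergesAlgebraically Γs Γ) : IsApproximatedBy Γs Γ := by
  obtain ⟨S, _, ρs, ρ, h₁, rfl, h₂⟩ := h
  rintro _ ⟨s, rfl⟩
  refine ⟨fun n => ρs n s, fun n => ?_, h₂ s⟩
  rw [h₁ n]
  exact ⟨s, rfl⟩

/-- Large separated families in `Γ` on which the products `(f⁻¹o|f'o)` are bounded give a lower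
bound for the entropy of all semigroups near `Γ`. -/
theorem exists_eventually_le_entropy [ProperSpace X] [IsGromovHyperbolic X] (o : X)
    {Γs : ℕ → Subsemigroup (X ≃ᵢ X)} {Γ : Subsemigroup (X ≃ᵢ X)} (happ : IsApproximatedBy Γs Γ)
    {ε h h' C L : ℝ} (hε : 0 < ε) (h₀ : 0 ≤ h) (hh : h < h') :
    ∃ m₀ : ℝ, ∀ m ≥ m₀, ∀ B : Finset (X ≃ᵢ X), (∀ f ∈ B, f ∈ Γ) →
      (B : Set (X ≃ᵢ X)).Pairwise (fun f f' => ε < dist (f o) (f' o)) →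
      (∀ f ∈ B, dist (f o) o ≤ m) → Real.exp (h' * m) ≤ B.card →
      (∀ f ∈ B, ∀ f' ∈ B, L ≤ dist (f o) o → L ≤ dist (f' o) o →
        gromovProd o (f.symm o) (f' o) ≤ C) →
      ∀ᶠ n in atTop, (h : EReal) ≤ entropy o (Γs n) := by
  obtain ⟨δ, hδ₀, hδ⟩ := IsGromovHyperbolic.exists_delta (X := X)
  let C' := max C 0 + 1
  have hC'0 : 0 ≤ C' := by positivity
  -- The Schottky constants with room to spare: each orbit point will move by less than `1/2`, which
  -- changes products, distances between two of them, and length differences by at most `1`.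
  -- Likewise `N = j + 1` below.
  obtain ⟨m₀, H⟩ := exists_annulus_subset o (L := max L (2 * C' + 2 * δ + 2))
    (R := 2 * C' + 6 * δ + 5) hε h₀ hh (by positivity)
  refine ⟨m₀, fun m hm B hBΓ hB hBm hcard hBC => ?_⟩
  obtain ⟨j, F, hFB, hFR, hF, hFcard⟩ := H m hm B hB hBm hcard
  choose! γ hγ hγt using fun f hf => happ f (hBΓ f hf)
  have hev : ∀ᶠ n in atTop, ∀ f ∈ F, dist (γ f n o) (f o) < 1 / 2 ∧
      dist ((γ f n).symm o) (f.symm o) < 1 / 2 :=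
    (Finset.eventually_all F).2 fun f hf =>
      (hγt f (hFB hf)).eventually_dist_lt o (by norm_num)
  filter_upwards [hev] with n hn
  have hd : ∀ f ∈ F, dist (γ f n o) o ≤ dist (f o) o + 1 / 2 ∧
      dist (f o) o ≤ dist (γ f n o) o + 1 / 2 := fun f hf => by
    have e₁ := (hn f hf).1
    have e₂ := dist_triangle (γ f n o) (f o) o
    have e₃ := dist_triangle_left (f o) o (γ f n o)
    exact ⟨by linarith, by linarith⟩
  refine le_entropy_of_schottky (ι := F) (g := fun f => γ f n) (N := j + 1) (C := C') hδ₀ hδ hC'0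
    ?_ ?_ ?_ ?_ (Nat.succ_pos j) ?_ ?_ (Γs n) fun f => hγ f (hFB f.2) n
  · rintro ⟨f, hf⟩ ⟨f', hf'⟩
    have e₁ := hBC f (hFB hf) f' (hFB hf') ((le_max_left _ _).trans (hF f hf).1)
      ((le_max_left _ _).trans (hF f' hf').1)
    have e₂ := gromovProd_le_add_dist_left o ((γ f n).symm o) (f.symm o) (γ f' n o)
    have e₃ := gromovProd_le_add_dist_right o (f.symm o) (γ f' n o) (f' o)
    have e₄ := (hn f hf).2
    have e₅ := (hn f' hf').1
    have e₆ : C ≤ max C 0 := le_max_left _ _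
    simp only [C']
    linarith
  · rintro ⟨f, hf⟩
    have e₁ := (le_max_right _ _).trans (hF f hf).1
    have e₂ := (hd f hf).2
    simp only
    linarith
  · rintro ⟨f, hf⟩ ⟨f', hf'⟩
    have e₁ := hF f hf
    have e₂ := hF f' hf'
    have e₃ := hd f hf
    have e₄ := hd f' hf'
    simp only
    linarith
  · rintro ⟨f, hf⟩ ⟨f', hf'⟩ hne
    have e₁ : 2 * C' + 6 * δ + 5 ≤ dist (f o) (f' o) := hFR hf hf' fun h => hne (Subtype.ext h)
    have e₂ := (hn f hf).1
    have e₃ := (hn f' hf').1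
    have e₄ := dist_triangle4 (f o) (γ f n o) (γ f' n o) (f' o)
    rw [dist_comm (f o) (γ f n o)] at e₄
    simp only
    linarith
  · rintro ⟨f, hf⟩
    have e₁ := hF f hf
    have e₂ := hd f hf
    push_cast
    linarith
  · rw [Fintype.card_coe]
    push_cast
    exact hFcard

end Approximation

/-! ### Ultrafilters of exponential growth -/

section Growth

open Asymptotics

/-- A set of exponential growth carries an ultrafilter all of whose members have the same growth. -/
theorem exists_ultrafilter_growth {ι : Type*} (ℓ : ι → ℝ) (hfin : ∀ n : ℕ, {i | ℓ i ≤ n}.Finite)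
    {h : ℝ} (h₀ : 0 ≤ h)
    (H : ¬ (fun n : ℕ => ({i | ℓ i ≤ n}.ncard : ℝ)) =O[atTop] fun n : ℕ => Real.exp (h * n)) :
    ∃ F : Ultrafilter ι, Tendsto ℓ F atTop ∧
      ∀ V ∈ F, ∀ K : ℝ, ∃ᶠ n : ℕ in atTop, K * Real.exp (h * n) ≤ (V ∩ {i | ℓ i ≤ n}).ncard := by
  let light : Set ι → Prop := fun V =>
    (fun n : ℕ => ((V ∩ {i | ℓ i ≤ n}).ncard : ℝ)) =O[atTop] fun n : ℕ => Real.exp (h * n)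
  have hmono : ∀ t, light t → ∀ s ⊆ t, light s := by
    intro t ht s hst
    refine IsBigO.trans (isBigO_of_le _ fun n => ?_) ht
    simp only [Real.norm_natCast, Nat.cast_le]
    exact Set.ncard_le_ncard (Set.inter_subset_inter_left _ hst)
      ((hfin n).subset Set.inter_subset_right)
  have hunion : ∀ s, light s → ∀ t, light t → light (s ∪ t) := by
    intro s hs t ht
    refine IsBigO.trans (isBigO_of_le _ fun n => ?_) (hs.add ht)
    rw [Real.norm_natCast, ← Nat.cast_add, Real.norm_natCast, Nat.cast_le, Set.union_inter_distrib_right]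
    exact Set.ncard_union_le _ _
  have hball : ∀ R : ℝ, light {i | ℓ i ≤ R} := by
    intro R
    have hR : {i | ℓ i ≤ R}.Finite :=
      (hfin ⌈R⌉₊).subset fun i hi => le_trans hi (Nat.le_ceil R)
    refine IsBigO.of_bound ({i | ℓ i ≤ R}.ncard : ℝ) (Eventually.of_forall fun n => ?_)
    rw [Real.norm_natCast, Real.norm_eq_abs, Real.abs_exp]
    refine le_trans ?_ (le_mul_of_one_le_right (Nat.cast_nonneg _)
      (Real.one_le_exp (mul_nonneg h₀ n.cast_nonneg)))
    exact_mod_cast Set.ncard_le_ncard Set.inter_subset_left hR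
  -- Light sets form an ideal, proper by `H`. An ultrafilter finer than the dual filter contains no
  -- light set.
  let G : Filter ι := comk light
    (hmono _ (hball 0) ∅ (Set.empty_subset _)) hmono hunion
  have hG : G.NeBot := by
    rw [neBot_iff, Ne, ← empty_mem_iff_bot, mem_comk, Set.compl_empty]
    simpa [light] using H
  refine ⟨Ultrafilter.of G, ?_, fun V hV K => ?_⟩
  · refine Tendsto.mono_left (tendsto_atTop.2 fun R => ?_) (Ultrafilter.of_le G)
    refine mem_comk.2 (hmono _ (hball R) _ fun i hi => ?_)
    exact (not_le.1 (show ¬ R ≤ ℓ i from hi)).le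
  · have hV' : ¬ light V := by
      intro hlight
      have : Vᶜ ∈ Ultrafilter.of G := Ultrafilter.of_le G (mem_comk.2 (by rwa [compl_compl]))
      exact Ultrafilter.compl_notMem_iff.2 hV this
    intro hK
    refine hV' (IsBigO.of_bound K ?_)
    filter_upwards [hK] with n hn
    rw [Real.norm_natCast, Real.norm_eq_abs, Real.abs_exp]
    exact (not_le.1 hn).le

theorem not_isBigO_of_lt_criticalExponent {X : Type*} [MetricSpace X] {o : X} {P : Set X}
    {h h' : ℝ} (hh : h < h') (hP : (h' : EReal) < criticalExponent o P)
    (hfin : ∀ n : ℕ, (Metric.closedBall o (n : ℝ) ∩ P).Finite) :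
    ¬ (fun n : ℕ => ((Metric.closedBall o (n : ℝ) ∩ P).ncard : ℝ)) =O[atTop]
      fun n : ℕ => Real.exp (h * n) := by
  intro H
  obtain ⟨K, hK⟩ := H.bound
  have h₁ : Tendsto (fun n : ℕ => Real.exp ((h' - h) * n)) atTop atTop :=
    Real.tendsto_exp_atTop.comp
      (tendsto_natCast_atTop_atTop.const_mul_atTop (sub_pos.2 hh))
  obtain ⟨n, ⟨⟨hn, hKn⟩, hn'⟩, hn0⟩ := (((frequently_lt_of_lt_limsup (by isBoundedDefault)
    hP).and_eventually hK).and_eventually (h₁.eventually_ge_atTop K)).and_eventually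
      (eventually_gt_atTop 0) |>.exists
  rw [EReal.lt_div_iff (by exact_mod_cast hn0) (EReal.coe_ne_top _), ← EReal.coe_mul,
    ← EReal.log_exp ((h' * n : ℝ) : EReal), ENNReal.log_lt_log_iff, EReal.exp_coe,
    ← (hfin n).cast_ncard_eq] at hn
  rw [Real.norm_natCast, Real.norm_eq_abs, Real.abs_exp] at hKn
  have h₂ : Real.exp (h' * n) < (Metric.closedBall o (n : ℝ) ∩ P).ncard := by
    have : ENNReal.ofReal (Real.exp (h' * n)) <
        ENNReal.ofReal ((Metric.closedBall o (n : ℝ) ∩ P).ncard) := by simpa using hn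
    exact (ENNReal.ofReal_lt_ofReal_iff_of_nonneg (Real.exp_pos _).le).1 this
  have h₃ : K * Real.exp (h * n) ≤ Real.exp ((h' - h) * n) * Real.exp (h * n) :=
    mul_le_mul_of_nonneg_right hn' (Real.exp_pos _).le
  rw [← Real.exp_add, show (h' - h) * (n : ℝ) + h * n = h' * n by ring] at h₃
  linarith

end Growth

/-! ### Indexed families; the case of distinct limits -/

section Families

variable {X ι : Type*} [MetricSpace X] {o : X}
  {Γs : ℕ → Subsemigroup (X ≃ᵢ X)} {Γ : Subsemigroup (X ≃ᵢ X)}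

theorem finite_setOf_dist_le_of_separated [ProperSpace X] (o : X) {ε : ℝ} (hε : 0 < ε)
    {g : ι → X ≃ᵢ X} (hsep : ∀ i j, i ≠ j → ε < dist (g i o) (g j o)) (R : ℝ) :
    {i | dist (g i o) o ≤ R}.Finite := by
  classical
  obtain ⟨N, hN⟩ := exists_card_le_of_separated o hε R
  by_contra hinf
  obtain ⟨T, hT, hTN⟩ := Set.Infinite.exists_subset_card_eq hinf (N + 1)
  have hinj : Function.Injective g := fun i j hij => by
    by_contra hne
    have := hsep i j hne
    rw [hij, dist_self] at this
    linarith
  have := hN 1 (T.image g) ?_ ?_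
  · rw [Finset.card_image_of_injective _ hinj] at this
    omega
  · rw [Finset.coe_image]
    rintro _ ⟨i, -, rfl⟩ _ ⟨j, -, rfl⟩ hne
    exact hsep i j fun h => hne (by rw [h])
  · intro f hf
    obtain ⟨i, hi, rfl⟩ := Finset.mem_image.1 hf
    exact hT hi

theorem exists_eventually_le_entropy_of_family [ProperSpace X] [IsGromovHyperbolic X] (ι : Type*) (o : X)
    (happ : IsApproximatedBy Γs Γ)
    {ε h h' C L : ℝ} (hε : 0 < ε) (h₀ : 0 ≤ h) (hh : h < h') :
    ∃ m₀ : ℝ, ∀ m ≥ m₀, ∀ (T : Finset ι) (f : ι → X ≃ᵢ X), (∀ i ∈ T, f i ∈ Γ) →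
      (T : Set ι).Pairwise (fun i j => ε < dist (f i o) (f j o)) →
      (∀ i ∈ T, dist (f i o) o ≤ m) → Real.exp (h' * m) ≤ T.card →
      (∀ i ∈ T, ∀ j ∈ T, L ≤ dist (f i o) o → L ≤ dist (f j o) o →
        gromovProd o ((f i).symm o) (f j o) ≤ C) →
      ∀ᶠ n in atTop, (h : EReal) ≤ entropy o (Γs n) := by
  classical
  obtain ⟨m₀, H⟩ := exists_eventually_le_entropy o happ (C := C) (L := L) hε h₀ hh
  refine ⟨m₀, fun m hm T f hΓ hT hTm hcard hC => H m hm (T.image f) ?_ ?_ ?_ ?_ ?_⟩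
  · simpa using hΓ
  · rw [Finset.coe_image]
    rintro _ ⟨i, hi, rfl⟩ _ ⟨j, hj, rfl⟩ hne
    exact hT hi hj fun h => hne (by rw [h])
  · simpa using hTm
  · rwa [Finset.card_image_of_injOn]
    intro i hi j hj hij
    by_contra hne
    have : ε < dist (f i o) (f j o) := hT hi hj hne
    rw [hij, dist_self] at this
    linarith
  · simpa using hC

/-- The family is `a g_i`. Since `(a g_i)⁻¹o` is within `dist (a o) o` of `g_i⁻¹o`, its products are
controlled by `(g_i⁻¹o|a g_j o)`, which is bounded when the limits differ. -/
theorem eventually_le_entropy_of_not_together [ProperSpace X] [IsGromovHyperbolic X] (happ : IsApproximatedBy Γs Γ) {ε h h' : ℝ}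
    (hε : 0 < ε) (h₀ : 0 ≤ h) (hh : h < h') {g : ι → X ≃ᵢ X} (hg : ∀ i, g i ∈ Γ)
    (hsep : ∀ i j, i ≠ j → ε < dist (g i o) (g j o))
    (hfin : ∀ n : ℕ, {i | dist (g i o) o ≤ n}.Finite) {F : Filter ι}
    (hF : ∀ V ∈ F, ∀ K : ℝ, ∃ᶠ n : ℕ in atTop,
      K * Real.exp (h' * n) ≤ (V ∩ {i | dist (g i o) o ≤ n}).ncard)
    (h₁ : TogetherAtInfinity o F (fun i => g i o) F (fun i => g i o))
    (h₂ : TogetherAtInfinity o F (fun i => (g i).symm o) F (fun i => (g i).symm o))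
    {a : X ≃ᵢ X} (ha : a ∈ Γ ∨ a = 1)
    (hna : ¬ TogetherAtInfinity o F (fun i => a (g i o)) F (fun i => (g i).symm o)) :
    ∀ᶠ n in atTop, (h : EReal) ≤ entropy o (Γs n) := by
  obtain ⟨C, hC⟩ := exists_eventually_gromovProd_le (h₁.map_isometry a) h₂ hna
  obtain ⟨V, hV, hVC⟩ := mem_prod_same_iff.1 hC
  obtain ⟨m₀, H⟩ := exists_eventually_le_entropy_of_family ι o happ (C := C + dist (a o) o)
    (L := 0) hε h₀ hh
  -- This factor pays for enlarging the radius from `n` to `n + dist (a o) o` after translation by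
  -- `a`.
  obtain ⟨n, hn, hn'⟩ := ((hF V hV (Real.exp (h' * dist (a o) o))).and_eventually
    (tendsto_natCast_atTop_atTop.eventually_ge_atTop m₀)).exists
  have hfinV := (hfin n).subset (Set.inter_subset_right (s := V))
  refine H (n + dist (a o) o) (by linarith [dist_nonneg (x := a o) (y := o)]) hfinV.toFinset
    (fun i => a * g i) ?_ ?_ ?_ ?_ ?_
  · intro i _
    rcases ha with ha | rfl
    · exact Γ.mul_mem ha (hg i)
    · rw [one_mul]
      exact hg i
  · intro i _ j _ hij
    simp only [IsometryEquiv.mul_apply, a.dist_eq]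
    exact hsep i j hij
  · intro i hi
    have hi : dist (g i o) o ≤ n := ((Set.Finite.mem_toFinset _).1 hi).2
    rw [IsometryEquiv.mul_apply]
    have := dist_triangle (a (g i o)) (a o) o
    rw [a.dist_eq] at this
    linarith
  · rw [← Set.ncard_eq_toFinset_card _ hfinV, mul_add, Real.exp_add, mul_comm]
    exact hn
  · intro i hi j hj _ _
    have hi := ((Set.Finite.mem_toFinset _).1 hi).1
    have hj := ((Set.Finite.mem_toFinset _).1 hj).1
    have e₁ : gromovProd o (a (g j o)) ((g i).symm o) ≤ C := hVC (Set.mk_mem_prod hj hi)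
    have e₂ := gromovProd_le_add_dist_left o ((a * g i).symm o) ((g i).symm o) (a (g j o))
    have e₃ : dist ((a * g i).symm o) ((g i).symm o) = dist (a o) o := by
      have : (a * g i).symm o = (g i).symm (a.symm o) := rfl
      rw [this, (g i).symm.dist_eq, dist_symm_base]
    rw [IsometryEquiv.mul_apply]
    rw [gromovProd_comm] at e₁
    linarith

end Families

/-! ### The case of a boundary point fixed by the semigroup -/

section FixedPoint

variable {X ι : Type*} [MetricSpace X] {o : X} {δ : ℝ} {Γ : Subsemigroup (X ≃ᵢ X)}
  {F : Filter ι} {z : ι → X}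

/-- If `z` converges to a boundary point fixed by `b`, then so does `b z`. -/
theorem eventually_gromovProd_map_le [NeBot F]
    (hδ : ∀ o x y z : X, min (gromovProd o x y) (gromovProd o y z) - δ ≤ gromovProd o x z)
    {b : X ≃ᵢ X} (hb : TogetherAtInfinity o F z F fun i => b (z i)) {x : X} {c : ℝ}
    (hx : ∀ᶠ i in F, gromovProd o x (z i) ≤ c) :
    ∀ᶠ i in F, gromovProd o x (b (z i)) ≤ c + δ := by
  filter_upwards [(hb.symm.eventually (c + δ + 1)).curry] with i hi
  obtain ⟨j, hj, hj'⟩ := (hi.and hx).exists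
  have e := hδ o x (b (z i)) (z j)
  by_contra! hc
  have := lt_min hc (show c + δ < gromovProd o (b (z i)) (z j) by linarith)
  linarith

theorem pow_mem_or_eq_one {M : Type*} [Monoid M] {Γ : Subsemigroup M} {a : M} (ha : a ∈ Γ)
    (k : ℕ) : a ^ k ∈ Γ ∨ a ^ k = 1 := by
  induction k with
  | zero => exact Or.inr (pow_zero a)
  | succ k ih =>
    left
    rw [pow_succ]
    rcases ih with h | h
    · exact Γ.mul_mem h ha
    · rwa [h, one_mul]

variable [NeBot F] {a : X ≃ᵢ X} {C : ℝ}

theorem eventually_le_gromovProd_symm_pow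
    (hδ : ∀ o x y z : X, min (gromovProd o x y) (gromovProd o y z) - δ ≤ gromovProd o x z)
    (hfix : ∀ b : X ≃ᵢ X, b ∈ Γ ∨ b = 1 → TogetherAtInfinity o F z F fun i => b (z i))
    (ha : a ∈ Γ) (haz : ∀ᶠ i in F, gromovProd o (a o) (z i) ≤ C) (k : ℕ) :
    ∀ᶠ i in F, dist (a o) o - C - δ ≤ gromovProd o (a.symm o) ((a ^ k) (z i)) := by
  filter_upwards [eventually_gromovProd_map_le hδ
    (hfix _ (pow_mem_or_eq_one ha (k + 1))) haz] with i hi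
  have e := gromovProd_symm_add_gromovProd o ((a ^ k) (z i)) a
  rw [pow_succ', IsometryEquiv.mul_apply] at hi
  linarith

/-- The fixed point is repelling for `a`: each application of `a` brings points near it closer to
`o` by at least `1`, and `a ^ k` cannot shorten distances to `o` by more than its own length. -/
theorem le_dist_pow
    (hδ : ∀ o x y z : X, min (gromovProd o x y) (gromovProd o y z) - δ ≤ gromovProd o x z)
    (hfix : ∀ b : X ≃ᵢ X, b ∈ Γ ∨ b = 1 → TogetherAtInfinity o F z F fun i => b (z i))
    (ha : a ∈ Γ) (haz : ∀ᶠ i in F, gromovProd o (a o) (z i) ≤ C)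
    (hlen : 2 * C + 2 * δ + 1 ≤ dist (a o) o) (k : ℕ) : (k : ℝ) ≤ dist ((a ^ k) o) o := by
  have h : ∀ᶠ i in F, dist ((a ^ k) (z i)) o ≤ dist (z i) o - k := by
    induction k with
    | zero => exact Eventually.of_forall fun i => by simp
    | succ k ih =>
      filter_upwards [ih, eventually_le_gromovProd_symm_pow hδ hfix ha haz k] with i hi hi'
      have e₁ := dist_eq_sub_gromovProd o (a.symm o) ((a ^ k) (z i))
      rw [dist_symm_base, dist_symm_apply_base, dist_comm] at e₁
      rw [pow_succ', IsometryEquiv.mul_apply]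
      push_cast
      linarith
  obtain ⟨i, hi⟩ := h.exists
  have e := dist_triangle_left (z i) o ((a ^ k)⁻¹ o)
  have e₁ : dist ((a ^ k)⁻¹ o) (z i) = dist ((a ^ k) (z i)) o := by
    rw [dist_comm ((a ^ k) (z i))]
    exact dist_symm_apply_base (a ^ k) o (z i)
  have e₂ : dist ((a ^ k)⁻¹ o) o = dist ((a ^ k) o) o := dist_symm_base (a ^ k) o
  linarith

/-- If `a` does not bring `x` closer to `o`, then `(a⁻¹o|x)` is at most half the length of `a`. But
`a⁻¹o` points towards the fixed point, so `x` does not. -/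
theorem eventually_gromovProd_le_of_dist_le
    (hδ : ∀ o x y z : X, min (gromovProd o x y) (gromovProd o y z) - δ ≤ gromovProd o x z)
    (hfix : ∀ b : X ≃ᵢ X, b ∈ Γ ∨ b = 1 → TogetherAtInfinity o F z F fun i => b (z i))
    (ha : a ∈ Γ) (haz : ∀ᶠ i in F, gromovProd o (a o) (z i) ≤ C)
    (hlen : 2 * C + 4 * δ + 1 ≤ dist (a o) o) {x : X} (hx : dist x o ≤ dist (a x) o) :
    ∀ᶠ i in F, gromovProd o x (z i) ≤ dist (a o) o / 2 + δ := by
  filter_upwards [eventually_le_gromovProd_symm_pow hδ hfix ha haz 0] with i hi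
  rw [pow_zero, show (1 : X ≃ᵢ X) (z i) = z i from rfl] at hi
  have e₁ := dist_eq_sub_gromovProd o (a.symm o) x
  rw [dist_symm_base, dist_symm_apply_base, dist_comm] at e₁
  have e₂ := hδ o (a.symm o) (z i) x
  rw [gromovProd_comm o (z i) x] at e₂
  by_contra! hc
  have := lt_min (show dist (a o) o / 2 + δ < gromovProd o (a.symm o) (z i) by linarith) hc
  linarith

/-- As `f` fixes the boundary point and `f o` is away from it, `f⁻¹o` is close to it, hence away
from `f' o`. -/
theorem gromovProd_symm_le_of_eventually
    (hδ : ∀ o x y z : X, min (gromovProd o x y) (gromovProd o y z) - δ ≤ gromovProd o x z)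
    {f f' : X ≃ᵢ X} (hfix : TogetherAtInfinity o F z F fun i => f (z i))
    (hf : ∀ᶠ i in F, gromovProd o (f o) (z i) ≤ C)
    (hf' : ∀ᶠ i in F, gromovProd o (f' o) (z i) ≤ C)
    (hlen : 2 * C + 2 * δ + 1 ≤ dist (f o) o) :
    gromovProd o (f.symm o) (f' o) ≤ C + δ := by
  obtain ⟨i, hi, hi'⟩ := ((eventually_gromovProd_map_le hδ hfix hf).and hf').exists
  have e₁ := gromovProd_symm_add_gromovProd o (z i) f
  have e₂ := hδ o (f' o) (f.symm o) (z i)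
  rw [gromovProd_comm]
  by_contra! hc
  have := lt_min hc (show C + δ < gromovProd o (f.symm o) (z i) by linarith)
  linarith

theorem eventually_le_entropy_of_fixed [ProperSpace X] [IsGromovHyperbolic X]
    {Γs : ℕ → Subsemigroup (X ≃ᵢ X)} (happ : IsApproximatedBy Γs Γ) {ε h h' : ℝ}
    (hδ : ∀ o x y z : X, min (gromovProd o x y) (gromovProd o y z) - δ ≤ gromovProd o x z)
    (hδ₀ : 0 ≤ δ)
    (hε : 0 < ε) (h₀ : 0 ≤ h) (hh : h < h') {g : ι → X ≃ᵢ X} (hg : ∀ i, g i ∈ Γ)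
    (hsep : ∀ i j, i ≠ j → ε < dist (g i o) (g j o))
    (hfin : ∀ n : ℕ, {i | dist (g i o) o ≤ n}.Finite)
    (hgrowth : ∃ᶠ n : ℕ in atTop, Real.exp (h' * n) ≤ {i | dist (g i o) o ≤ n}.ncard)
    (hfix : ∀ b : X ≃ᵢ X, b ∈ Γ ∨ b = 1 → TogetherAtInfinity o F z F fun i => b (z i))
    (ha : a ∈ Γ) (haz : ∀ᶠ i in F, gromovProd o (a o) (z i) ≤ C)
    (hlen : 2 * C + 4 * δ + 1 ≤ dist (a o) o) :
    ∀ᶠ n in atTop, (h : EReal) ≤ entropy o (Γs n) := by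
  classical
  obtain ⟨h₁, hh₁, hh₁'⟩ := exists_between hh
  have hk : ∀ i, ∃ k : ℕ, (k : ℝ) ≤ 2 * dist (g i o) o ∧
      dist ((a ^ k) (g i o)) o ≤ dist (g i o) o ∧
      dist ((a ^ k) (g i o)) o ≤ dist (a ((a ^ k) (g i o))) o := by
    intro i
    -- Linear growth of `a ^ k` bounds the minimizer by `2 * dist (g i o) o`; the `+ 2` keeps `k +
    -- 1` in the range, for comparison with it.
    obtain ⟨k, -, hmin⟩ := Finset.exists_min_image (Finset.range (⌊2 * dist (g i o) o⌋₊ + 2))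
      (fun k => dist ((a ^ k) (g i o)) o) ⟨0, by simp⟩
    have hk₀ : dist ((a ^ k) (g i o)) o ≤ dist (g i o) o := by
      simpa using hmin 0 (by simp)
    have hk₁ : (k : ℝ) ≤ 2 * dist (g i o) o := by
      have e₁ := le_dist_pow hδ hfix ha haz (by linarith) k
      have e₂ := dist_triangle_left ((a ^ k) o) o ((a ^ k) (g i o))
      rw [(a ^ k).dist_eq] at e₂
      linarith
    refine ⟨k, hk₁, hk₀, ?_⟩
    have := hmin (k + 1) (Finset.mem_range.2 (by
      have := Nat.le_floor hk₁
      omega))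
    rwa [pow_succ', IsometryEquiv.mul_apply] at this
  choose k hk₁ hk₂ hk₃ using hk
  let D := dist (a o) o / 2 + δ
  obtain ⟨m₀, H⟩ := exists_eventually_le_entropy_of_family ι o happ (C := D + δ)
    (L := 2 * D + 2 * δ + 1) hε h₀ hh₁
  have hexp := tendsto_natCast_atTop_atTop.eventually
    (eventually_add_mul_exp_lt (h₀.trans hh₁.le) hh₁' 0 2)
  obtain ⟨n, ⟨hn, hn'⟩, hnm⟩ := ((hgrowth.and_eventually hexp).and_eventually
    (tendsto_natCast_atTop_atTop.eventually_ge_atTop m₀)).exists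
  rw [Set.ncard_eq_toFinset_card _ (hfin n)] at hn
  have hT : ∀ i ∈ (hfin n).toFinset, dist (g i o) o ≤ n :=
    fun i hi => (hfin n).mem_toFinset.1 hi
  -- At most `2n + 1` exponents occur, a factor absorbed by passing from `h'` to `h₁`. A common
  -- exponent `l` preserves the separation.
  obtain ⟨l, -, hl⟩ := Finset.exists_le_card_fiber_of_nsmul_le_card_of_maps_to
    (s := (hfin n).toFinset) (t := Finset.range (2 * n + 1)) (f := k)
    (b := Real.exp (h₁ * n)) (fun i hi => by
      have e₁ := hk₁ i
      have e₂ := hT i hi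
      have : (k i : ℝ) ≤ (2 * n : ℕ) := by
        push_cast
        linarith
      exact Finset.mem_range.2 (Nat.lt_succ_of_le (by exact_mod_cast this))) ⟨0, by simp⟩ (by
      have e₁ : Real.exp (h₁ * n) ≤ Real.exp (h₁ * (n + 2)) :=
        Real.exp_le_exp.2 (mul_le_mul_of_nonneg_left (by linarith) (h₀.trans hh₁.le))
      have e₂ : (2 * n + 1 : ℝ) * Real.exp (h₁ * n) ≤ 2 * (n + 2) * Real.exp (h₁ * (n + 2)) :=
        mul_le_mul (by linarith) e₁ (Real.exp_pos _).le (by positivity)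
      rw [Finset.card_range, nsmul_eq_mul]
      push_cast
      linarith)
  have hmem : ∀ i, a ^ l * g i ∈ Γ := fun i => by
    rcases pow_mem_or_eq_one ha l with h | h
    · exact Γ.mul_mem h (hg i)
    · rw [h, one_mul]
      exact hg i
  have hD : ∀ i, k i = l → ∀ᶠ j in F, gromovProd o ((a ^ l * g i) o) (z j) ≤ D := by
    rintro i rfl
    exact eventually_gromovProd_le_of_dist_le hδ hfix ha haz hlen (hk₃ i)
  refine H n hnm _ (fun i => a ^ l * g i) (fun i _ => hmem i) ?_ ?_ hl ?_
  · intro i _ j _ hij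
    simp only [IsometryEquiv.mul_apply, (a ^ l).dist_eq]
    exact hsep i j hij
  · intro i hi
    obtain ⟨hi, hil⟩ := Finset.mem_filter.1 hi
    exact (hil ▸ hk₂ i).trans (hT i hi)
  · intro i hi j hj hLi _
    exact gromovProd_symm_le_of_eventually hδ (hfix _ (Or.inl (hmem i)))
      (hD i (Finset.mem_filter.1 hi).2) (hD j (Finset.mem_filter.1 hj).2) hLi

end FixedPoint

/-! ### Elements moving away from a boundary point -/

section LimitSet

variable {X ι : Type*} [MetricSpace X] [IsGromovHyperbolic X] {o : X} {Γ : Subsemigroup (X ≃ᵢ X)}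

/-- If the limit set has two points, then `Γ` contains long elements that move the base point away
from any given boundary point. -/
theorem exists_mem_dist_ge_of_nontrivial_limitSet (hΓ : (limitSet o Γ).Nontrivial) {F : Filter ι}
    [NeBot F] {z : ι → X} (hz : TogetherAtInfinity o F z F z) :
    ∃ C, ∀ R, ∃ a ∈ Γ, R ≤ dist (a o) o ∧ ∀ᶠ i in F, gromovProd o (a o) (z i) ≤ C := by
  obtain ⟨_, ⟨x, hx, rfl⟩, _, ⟨y, hy, rfl⟩, hne⟩ := hΓ
  rw [Ne, ConvSeq.limit_eq_iff, gromovClose_iff_togetherAtInfinity] at hne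
  -- Of two distinct limit points, at least one differs from the limit of `z`.
  obtain ⟨x, hx, hxz⟩ : ∃ x : ConvSeq o, (∀ i, x.1 i ∈ isomOrbit o (Γ : Set (X ≃ᵢ X))) ∧
      ¬ TogetherAtInfinity o atTop x.1 F z := by
    by_contra! h
    exact hne ((h x hx).trans (h y hy).symm)
  have hxx := gromovClose_iff_togetherAtInfinity.1 x.2
  obtain ⟨C, hC⟩ := exists_eventually_gromovProd_le hxx hz hxz
  refine ⟨C, fun R => ?_⟩
  have hR : ∀ᶠ i in atTop, R ≤ gromovProd o (x.1 i) (x.1 i) :=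
    (tendsto_id.prodMk tendsto_id).eventually (hxx.eventually R)
  obtain ⟨i, hi, hi'⟩ := (hR.and hC.curry).exists
  obtain ⟨a, ha, hai⟩ := hx i
  have hai : a o = x.1 i := hai
  rw [gromovProd_self] at hi
  refine ⟨a, ha, ?_, ?_⟩
  · rwa [hai]
  · rwa [hai]

end LimitSet

/-! ### Lower semicontinuity of the entropy -/

section Semicontinuity

variable {X : Type*} [MetricSpace X] [ProperSpace X] [IsGromovHyperbolic X] {o : X}
  [CompactSpace (GromovBoundary o)] {Γs : ℕ → Subsemigroup (X ≃ᵢ X)} {Γ : Subsemigroup (X ≃ᵢ X)}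

theorem eventually_le_entropy (happ : IsApproximatedBy Γs Γ) (hΓ : (limitSet o Γ).Nontrivial)
    {h : ℝ} (h₀ : 0 ≤ h) (hh : (h : EReal) < entropy o Γ) :
    ∀ᶠ n in atTop, (h : EReal) ≤ entropy o (Γs n) := by
  obtain ⟨δ, hδ₀, hδ⟩ := IsGromovHyperbolic.exists_delta (X := X)
  have hP : isomOrbit o (Γ : Set (X ≃ᵢ X)) ≠ ∅ := by
    obtain ⟨_, x, hx, -⟩ := hΓ.nonempty
    exact Set.Nonempty.ne_empty ⟨_, hx 0⟩
  rw [entropy, setEntropy, if_neg hP] at hh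
  simp only [lt_iSup_iff] at hh
  obtain ⟨S, ⟨ε, hε, hS⟩, hh⟩ := hh
  obtain ⟨h₂, hh₂, hh₂'⟩ := EReal.exists_between_coe_real hh
  obtain ⟨h₁, hh₁, hh₁'⟩ := exists_between (EReal.coe_lt_coe_iff.1 hh₂)
  let ι := ↥(isomOrbit o (Γ : Set (X ≃ᵢ X)) ∩ S)
  choose g hg hgo using fun i : ι => i.2.1
  have hgo : ∀ i, g i o = i := hgo
  have hsep : ∀ i j, i ≠ j → ε < dist (g i o) (g j o) := fun i j hij => by
    rw [hgo, hgo]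
    exact hS i.2.2 j.2.2 fun h => hij (Subtype.ext h)
  have himage : ∀ n : ℕ, Metric.closedBall o (n : ℝ) ∩ (isomOrbit o (Γ : Set (X ≃ᵢ X)) ∩ S) =
      Subtype.val '' {i : ι | dist (g i o) o ≤ n} := by
    intro n
    ext x
    constructor
    · rintro ⟨hx, hx'⟩
      refine ⟨⟨x, hx'⟩, ?_, rfl⟩
      change dist (g _ o) o ≤ n
      rw [hgo]
      exact hx
    · rintro ⟨i, hi, rfl⟩
      refine ⟨?_, i.2⟩
      change dist (g _ o) o ≤ n at hi
      rwa [hgo] at hi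
  have hfin : ∀ n : ℕ, {i | dist (g i o) o ≤ n}.Finite :=
    fun n => finite_setOf_dist_le_of_separated o hε hsep n
  obtain ⟨F, hFlen, hF⟩ := exists_ultrafilter_growth (fun i => dist (g i o) o) hfin
    (h₀.trans hh₁.le) (by
      have := not_isBigO_of_lt_criticalExponent hh₁' hh₂' fun n => by
        rw [himage n]
        exact (hfin n).image _
      simpa only [himage, Set.ncard_image_of_injective _ Subtype.val_injective] using this)
  have hnt : Nontrivial (GromovBoundary o) := by
    obtain ⟨ξ, -, η, -, hne⟩ := hΓ
    exact ⟨ξ, η, hne⟩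
  have t₁ := togetherAtInfinity_orbit F g hFlen
  have t₂ := togetherAtInfinity_orbit F (fun i => (g i).symm) (by simpa only [dist_symm_base])
  -- If this holds, `b = 1` identifies the limits of `g_i o` and `g_i⁻¹o`, and the other `b` show
  -- that this point is fixed by `Γ`.
  by_cases hall : ∀ b : X ≃ᵢ X, b ∈ Γ ∨ b = 1 →
      TogetherAtInfinity o F (fun i => b (g i o)) F (fun i => (g i).symm o)
  · obtain ⟨C, hC⟩ := exists_mem_dist_ge_of_nontrivial_limitSet hΓ t₁
    obtain ⟨a, ha, hlen, haz⟩ := hC (2 * C + 4 * δ + 1)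
    refine eventually_le_entropy_of_fixed happ hδ hδ₀ hε h₀ hh₁ hg hsep hfin ?_
      (fun b hb => (hall 1 (Or.inr rfl)).trans (hall b hb).symm) ha haz hlen
    simpa using hF Set.univ univ_mem 1
  · push Not at hall
    obtain ⟨b, hb, hnb⟩ := hall
    exact eventually_le_entropy_of_not_together happ hε h₀ hh₁ hg hsep hfin hF t₁ t₂ hb hnb

end Semicontinuity

theorem mainTheorem7 {X : Type*} [MetricSpace X] [ProperSpace X] [IsGromovHyperbolic X] (o : X)
    [CompactSpace (GromovBoundary o)]
    (Γs : ℕ → Subsemigroup (X ≃ᵢ X)) (Γ : Subsemigroup (X ≃ᵢ X))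
    (hconv : ConvergesGeometrically Γs Γ ∨ ConvergesAlgebraically Γs Γ ∨ IsApproximatedBy Γs Γ)
    (hΓ : (limitSet o Γ).Nontrivial) :
    entropy o Γ ≤ Filter.liminf (fun n => entropy o (Γs n)) Filter.atTop := by
  have happ : IsApproximatedBy Γs Γ := by
    rcases hconv with h | h | h
    · exact h.1
    · exact isApproximatedBy_of_convergesAlgebraically h
    · exact h
  refine le_of_forall_lt fun c hc => ?_
  obtain ⟨h, hch, hh⟩ := EReal.exists_between_coe_real hc
  refine lt_of_lt_of_le hch (le_liminf_of_le (by isBoundedDefault) ?_)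
  -- The growth argument needs `0 ≤ h`; negative values are covered by nonnegativity of the entropy,
  -- including that of an empty semigroup.
  rcases lt_or_ge h 0 with hneg | h₀
  · exact Eventually.of_forall fun n =>
      (EReal.coe_nonpos.2 hneg.le).trans (setEntropy_nonneg _ _)
  · exact eventually_le_entropy happ hΓ h₀ hh
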